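/- There exist absolute constants $C_3>0$ and $C_4>0$ such that the following holds. Let $n\ge 1$ and let $X_1,\dots,X_n$ be identically distributed, $1$-dependent random variables with values in the non-negative integers, i.e. whenever $1\le s<t\le n$ and $t-s>1$, the $\sigma$-algebras generated by $X_1,\dots,X_s$ and by $X_t,\dots,X_n$ are independent; assume also that $\mathbb E X_kX_{k+1}=\mathbb E X_1X_2$ for all $1\le k\le n-1$ (as is the case for a stationary sequence). Put $S_n=X_1+\dots+X_n$, $\nu_1=\mathbb E X_1$ and $\nu_2=\mathbb E X_1(X_1-1)$, and assume $\nu_1>0$. Let $x$ be a positive integer, let $C_0\ge 1$ be a real number, and put $$y=\frac{x-n\nu_1}{n\nu_1},\qquad \gamma=e^{1.5\,C_0}\max(\nu_1^2,\nu_2,\mathbb E X_1X_2),$$ $$\lambda^*=\nu_1\Big(1-\frac{\nu_1}{1-\nu_1}\,y\Big),\qquad \Lambda^*(y)=n\sum_{j=2}^\infty\frac1j\Big(\frac{\nu_1}{1-\nu_1}\Big)^j y^j .$$ Assume that $$X_1\le C_0\ \text{ almost surely},\qquad e^{5C_0}\nu_1\le 0.002,\qquad |y|\le\tfrac1{10},$$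 $$\nu_2\le\frac{\nu_1e^{-1.5\,C_0}}{20},\qquad \mathbb E X_1X_2\le\frac{\nu_1e^{-1.5\,C_0}}{20},\qquad x>n\nu_1 .$$ Let $Z_n^*$ be a Poisson random variable with parameter $n\lambda^*$. Then there is a real number $\theta$ with $|\theta|\le 1$ such that $$\frac{P(S_n\ge x)}{P(Z_n^*\ge x)}=e^{\Lambda^*(y)}\,(1+C_3\gamma y^2)^n\,\Big(1+C_4\,\theta\,\gamma\sqrt{n\nu_1}\,\big(\nu_1^{-1}+ny^2\big)\Big).$$ -/

import Mathlib

open MeasureTheory ProbabilityTheory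
open scoped NNReal

noncomputable section

/-- The finite sequence `X 1, …, X n` is `m`-dependent: whenever `1 ≤ s < t ≤ n` and `t - s > m`,
the σ-algebras generated by `X 1, …, X s` and by `X t, …, X n` are independent. -/
def IsMDependent {Ω : Type*} [MeasurableSpace Ω] (m n : ℕ) (X : ℕ → Ω → ℕ) (μ : Measure Ω) : Prop :=
  ∀ s t : ℕ, 1 ≤ s → t ≤ n → s + m < t →
    Indep (⨆ i ∈ Set.Icc 1 s, MeasurableSpace.comap (X i) inferInstance)
      (⨆ i ∈ Set.Icc t n, MeasurableSpace.comap (X i) inferInstance) μ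

/-- First factorial moment `E Y`. -/
def factMoment1 {Ω : Type*} [MeasurableSpace Ω] (Y : Ω → ℕ) (μ : Measure Ω) : ℝ :=
  ∫ ω, (Y ω : ℝ) ∂μ

/-- Second factorial moment `E Y (Y - 1)`. -/
def factMoment2 {Ω : Type*} [MeasurableSpace Ω] (Y : Ω → ℕ) (μ : Measure Ω) : ℝ :=
  ∫ ω, (Y ω : ℝ) * ((Y ω : ℝ) - 1) ∂μ

/-- Mixed moment `E Y Z`. -/
def mixedMoment {Ω : Type*} [MeasurableSpace Ω] (Y Z : Ω → ℕ) (μ : Measure Ω) : ℝ :=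
  ∫ ω, (Y ω : ℝ) * (Z ω : ℝ) ∂μ

/-- The relative deviation `y = (x - n ν₁) / (n ν₁)`. -/
def relDev (n x : ℕ) (ν₁ : ℝ) : ℝ := ((x : ℝ) - n * ν₁) / (n * ν₁)

/-- `γ = exp (1.5 C₀) max (ν₁², ν₂, E X₁X₂)`, where `κ` stands for `E X₁X₂`. -/
def gammaCoeff (C₀ ν₁ ν₂ κ : ℝ) : ℝ :=
  Real.exp (1.5 * C₀) * max (max (ν₁ ^ 2) ν₂) κ

/-- `λ* = ν₁ (1 - ν₁ y / (1 - ν₁))`. -/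
def lambdaStar (ν₁ y : ℝ) : ℝ := ν₁ * (1 - ν₁ / (1 - ν₁) * y)

/-- `Λ*(y) = n ∑_{j ≥ 2} (1 / j) (ν₁ / (1 - ν₁))^j y^j` (summed with `j` shifted by `2`). -/
def LambdaStar (n : ℕ) (ν₁ y : ℝ) : ℝ :=
  n * ∑' j : ℕ, (1 / ((j + 2 : ℕ) : ℝ)) * (ν₁ / (1 - ν₁)) ^ (j + 2) * y ^ (j + 2)

/-- `P (Z ≥ x)` for a Poisson variable `Z` with parameter `r`. -/
def poissonTail (r : ℝ) (x : ℕ) : ℝ := (poissonMeasure r.toNNReal).real (Set.Ici x)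

end

/-!
The Stein–Chen method compares the tail of `S` with that of a Poisson variable of the same mean:
one-dependence turns the Stein equation into increments of its solution over a short block of
indices. These increments are dominated by a monotone envelope, whose expectation is controlled by
the tails of `S` themselves. As long as `ε = γ (1 / ν₁ + n y²)` is small, comparing at the level
where the ratio of the two tails is largest bounds that ratio, and then the relative error is
`O(ε)`; moving the Poisson parameter from `n ν₁` to `n λ*` costs another factor `1 + O(ε)`.

When `ε` is not small the claimed error exceeds the main term, so only an upper bound for the ratio
is left to prove. There the exponential Markov inequality at `1 + y` meets a lower bound for the
Poisson tail which loses only a factor `O(√(n ν₁))`.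
-/

/-- The point probability `e^{-L} L^k / k!` of a Poisson variable, for a real parameter `L`, so that
it can be differentiated in `L`. -/
noncomputable def poissonWeight (L : ℝ) (k : ℕ) : ℝ := Real.exp (-L) * L ^ k / k.factorial

section Poisson

variable {L : ℝ}

lemma exp_one_sub_inv_le {r : ℝ} (hr : 0 < r) : Real.exp (1 - r⁻¹) ≤ r :=
  (Real.le_log_iff_exp_le hr).1 (Real.one_sub_inv_le_log_of_pos hr)

lemma poissonWeight_pos (hL : 0 < L) (k : ℕ) : 0 < poissonWeight L k := by
  unfold poissonWeight; positivity

lemma succ_mul_poissonWeight_succ (L : ℝ) (k : ℕ) :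
    (k + 1) * poissonWeight L (k + 1) = L * poissonWeight L k := by
  simp only [poissonWeight, Nat.factorial_succ]
  push_cast
  field_simp
  ring

lemma hasSum_poissonWeight_add (hL : 0 ≤ L) (k : ℕ) :
    HasSum (fun j ↦ poissonWeight L (j + k)) (poissonTail L k) := by
  have hweight : ∀ i, (poissonMeasure L.toNNReal).real {i} = poissonWeight L i := fun i ↦ by
    rw [poissonMeasure_real_singleton, Real.coe_toNNReal _ hL, poissonWeight]
  have htail : poissonTail L k = 1 - ∑ i ∈ Finset.range k, poissonWeight L i := by
    have hcompl : Set.Ici k = ((Finset.range k : Finset ℕ) : Set ℕ)ᶜ := by ext i; simp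
    rw [poissonTail, hcompl, probReal_compl_eq_one_sub (by measurability),
      ← sum_measureReal_singleton]
    simp only [hweight]
  rw [htail, hasSum_nat_add_iff' k]
  exact hasSum_one_poissonMeasure ⟨L, hL⟩

lemma poissonTail_nonneg (L : ℝ) (k : ℕ) : 0 ≤ poissonTail L k := measureReal_nonneg

lemma poissonTail_le_one (L : ℝ) (k : ℕ) : poissonTail L k ≤ 1 := measureReal_le_one

lemma poissonTail_zero (L : ℝ) : poissonTail L 0 = 1 := by
  simp [poissonTail, Set.eq_univ_of_forall fun k : ℕ ↦ Set.mem_Ici.2 k.zero_le]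

lemma poissonTail_antitone (L : ℝ) : Antitone (poissonTail L) :=
  fun _ _ h ↦ measureReal_mono (Set.Ici_subset_Ici.2 h)

lemma poissonTail_eq_add_succ (hL : 0 ≤ L) (k : ℕ) :
    poissonTail L k = poissonWeight L k + poissonTail L (k + 1) := by
  refine (hasSum_poissonWeight_add hL k).unique ?_
  rw [← hasSum_nat_add_iff' 1, Finset.sum_range_one, zero_add, add_sub_cancel_left]
  simpa only [add_assoc, add_comm 1 k] using hasSum_poissonWeight_add hL (k + 1)

lemma sum_poissonWeight_eq (hL : 0 ≤ L) (k : ℕ) :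
    ∑ i ∈ Finset.range k, poissonWeight L i = 1 - poissonTail L k := by
  induction k with
  | zero => simp [poissonTail_zero]
  | succ k ih => rw [Finset.sum_range_succ, ih, poissonTail_eq_add_succ hL k]; ring

lemma poissonWeight_le_poissonTail (hL : 0 ≤ L) (k : ℕ) :
    poissonWeight L k ≤ poissonTail L k := by
  linarith [poissonTail_eq_add_succ hL k, poissonTail_nonneg L (k + 1)]

lemma poissonTail_pos (hL : 0 < L) (k : ℕ) : 0 < poissonTail L k :=
  (poissonWeight_pos hL k).trans_le (poissonWeight_le_poissonTail hL.le k)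

lemma poissonWeight_add_le (hL : 0 ≤ L) {x : ℕ} (hx : 0 < x) (j : ℕ) :
    poissonWeight L (j + x) ≤ poissonWeight L x * (L / x) ^ j := by
  have hfact : (x.factorial : ℝ) * x ^ j ≤ (j + x).factorial := by
    rw [add_comm j x]
    exact_mod_cast (Nat.mul_le_mul_left _ (Nat.pow_le_pow_left x.le_succ j)).trans
      Nat.factorial_mul_pow_le_factorial
  calc poissonWeight L (j + x)
      ≤ Real.exp (-L) * L ^ (j + x) / (x.factorial * x ^ j) := by
        unfold poissonWeight; gcongr
    _ = poissonWeight L x * (L / x) ^ j := by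
        rw [poissonWeight, div_pow, pow_add, div_mul_div_comm]; ring

lemma poissonWeight_mul_pow_le (hL : 0 ≤ L) (x j : ℕ) :
    poissonWeight L x * (L / (x + j)) ^ j ≤ poissonWeight L (j + x) := by
  have hfact : ((j + x).factorial : ℝ) ≤ x.factorial * (x + j) ^ j := by
    rw [add_comm j x, ← Nat.factorial_mul_ascFactorial]
    exact_mod_cast Nat.mul_le_mul_left _ (Nat.ascFactorial_le_pow_add x j)
  calc poissonWeight L x * (L / (x + j)) ^ j
      = Real.exp (-L) * L ^ (j + x) / (x.factorial * (x + j) ^ j) := by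
        unfold poissonWeight; rw [div_pow, pow_add, div_mul_div_comm]; ring
    _ ≤ poissonWeight L (j + x) := by unfold poissonWeight; gcongr

lemma sub_mul_poissonTail_le (hL : 0 < L) (x : ℕ) :
    (x - L) * poissonTail L x ≤ x * poissonWeight L x := by
  have hp := (poissonWeight_pos hL x).le
  rcases le_or_gt (x : ℝ) L with hxL | hLx
  · have := mul_nonpos_of_nonpos_of_nonneg (sub_nonpos.2 hxL) (poissonTail_nonneg L x)
    have : 0 ≤ x * poissonWeight L x := by positivity
    linarith
  have hx : (0 : ℝ) < x := hL.trans hLx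
  have htail : poissonTail L x ≤ poissonWeight L x * (1 - L / x)⁻¹ :=
    hasSum_le (poissonWeight_add_le hL.le (by exact_mod_cast hx))
      (hasSum_poissonWeight_add hL.le x)
      ((hasSum_geometric_of_lt_one (by positivity) ((div_lt_one hx).2 hLx)).mul_left _)
  have hsub : 1 - L / x = (x - L) / x := by field_simp
  rw [hsub, inv_div, ← mul_div_assoc, le_div_iff₀ (sub_pos.2 hLx)] at htail
  linarith

lemma exp_neg_two_mul_poissonWeight_le (hL : 0 < L) {x : ℕ} (hx : L ≤ x) {j : ℕ}
    (hj : j * (1 + (x - L) / √L) ≤ √L) :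
    Real.exp (-2) * poissonWeight L x ≤ poissonWeight L (j + x) := by
  set t := (x - L) / √L with ht
  have hs : 0 < √L := Real.sqrt_pos.2 hL
  have hss : √L * √L = L := Real.mul_self_sqrt hL.le
  have : 0 ≤ t := div_nonneg (sub_nonneg.2 hx) hs.le
  have hxt : (x : ℝ) - L = t * √L := by rw [ht]; field_simp
  have hjx : (0 : ℝ) < x + j := add_pos_of_pos_of_nonneg (hL.trans_le hx) j.cast_nonneg
  have hjt : 0 ≤ j * t := by positivity
  refine le_trans ?_ (poissonWeight_mul_pow_le hL.le x j)
  rw [mul_comm]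
  refine mul_le_mul_of_nonneg_left ?_ (poissonWeight_pos hL x).le
  calc Real.exp (-2) ≤ Real.exp (1 - (L / (x + j))⁻¹) ^ j := by
        rw [← Real.exp_nat_mul, Real.exp_le_exp, inv_div,
          show (1 : ℝ) - (x + j) / L = -((t * √L + j) / L) by rw [← hxt]; field_simp; ring,
          mul_neg, neg_le_neg_iff, ← mul_div_assoc, div_le_iff₀ hL]
        nlinarith [mul_nonneg hjt hs.le]
    _ ≤ (L / (x + j)) ^ j := by gcongr; exact exp_one_sub_inv_le (by positivity)

lemma poissonWeight_mul_sqrt_le (hL : 0 < L) {x : ℕ} (hx : L ≤ x) :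
    poissonWeight L x * √L ≤ Real.exp 2 * (1 + (x - L) / √L) * poissonTail L x := by
  set t := (x - L) / √L
  have ht0 : 0 ≤ t := div_nonneg (sub_nonneg.2 hx) (Real.sqrt_nonneg L)
  have hp := (poissonWeight_pos hL x).le
  set m := ⌊√L / (1 + t)⌋₊ + 1 with hm
  have hterm : ∀ j ∈ Finset.range m,
      Real.exp (-2) * poissonWeight L x ≤ poissonWeight L (j + x) := fun j hj ↦ by
    have hjm : j ≤ ⌊√L / (1 + t)⌋₊ := Nat.lt_succ_iff.1 (Finset.mem_range.1 hj)
    exact exp_neg_two_mul_poissonWeight_le hL hx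
      ((le_div_iff₀ (by positivity)).1 ((Nat.le_floor_iff (by positivity)).1 hjm))
  have hsum : m * (Real.exp (-2) * poissonWeight L x) ≤ poissonTail L x := by
    have := (Finset.card_nsmul_le_sum _ _ _ hterm).trans
      (sum_le_hasSum _ (fun j _ ↦ (poissonWeight_pos hL _).le) (hasSum_poissonWeight_add hL.le x))
    rwa [Finset.card_range, nsmul_eq_mul] at this
  have hmt : √L ≤ m * (1 + t) := by
    rw [← div_le_iff₀ (by positivity), hm, Nat.cast_succ]
    exact (Nat.lt_floor_add_one _).le
  calc poissonWeight L x * √L ≤ poissonWeight L x * (m * (1 + t)) := by gcongr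
    _ = Real.exp 2 * (1 + t) * (m * (Real.exp (-2) * poissonWeight L x)) := by
        rw [Real.exp_neg]; field_simp
    _ ≤ Real.exp 2 * (1 + t) * poissonTail L x := by gcongr

lemma factorial_le_exp_one_mul_sqrt {x : ℕ} (hx : x ≠ 0) :
    (x.factorial : ℝ) ≤ Real.exp 1 * √x * (x / Real.exp 1) ^ x := by
  obtain ⟨m, rfl⟩ := Nat.exists_eq_succ_of_ne_zero hx
  have h := Stirling.stirlingSeq'_antitone m.zero_le
  simp only [Function.comp, Nat.succ_eq_add_one, zero_add, Stirling.stirlingSeq_one] at h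
  rw [Stirling.stirlingSeq, div_le_iff₀ (by positivity), Real.sqrt_mul zero_le_two] at h
  refine h.trans_eq ?_
  field_simp

lemma pow_mul_exp_le_poissonTail (hL : 0 < L) {x : ℕ} (hx : L ≤ x) (hx3 : x ≤ 3 * L) :
    (L / x) ^ x * Real.exp (x - L) ≤ Real.exp 4 * (1 + (x - L) / √L) * poissonTail L x := by
  have hx0 : (0 : ℝ) < x := hL.trans_le hx
  have hp := (poissonWeight_pos hL x).le
  have hexp4 : Real.exp 4 = Real.exp 1 * Real.exp 1 * Real.exp 2 := by
    simp only [← Real.exp_add]; norm_num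
  have hsqrt : √x ≤ Real.exp 1 * √L := by
    have hexp : 3 ≤ Real.exp 1 ^ 2 := by nlinarith [Real.exp_one_gt_d9]
    rw [Real.sqrt_le_left (by positivity), mul_pow, Real.sq_sqrt hL.le]
    exact hx3.trans (by gcongr)
  calc (L / x) ^ x * Real.exp (x - L)
      = poissonWeight L x * (x.factorial / (x / Real.exp 1) ^ x) := by
        rw [poissonWeight, sub_eq_neg_add, Real.exp_add, ← Real.exp_one_pow x, div_pow, div_pow]
        field_simp
    _ ≤ poissonWeight L x * (Real.exp 1 * √x) := by
        gcongr
        rw [div_le_iff₀ (by positivity)]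
        exact factorial_le_exp_one_mul_sqrt (by exact_mod_cast hx0.ne')
    _ ≤ poissonWeight L x * (Real.exp 1 * (Real.exp 1 * √L)) := by gcongr
    _ = Real.exp 1 * Real.exp 1 * (poissonWeight L x * √L) := by ring
    _ ≤ Real.exp 1 * Real.exp 1 *
          (Real.exp 2 * (1 + (x - L) / √L) * poissonTail L x) := by
        gcongr ?_ * ?_; exact poissonWeight_mul_sqrt_le hL hx
    _ = Real.exp 4 * (1 + (x - L) / √L) * poissonTail L x := by rw [hexp4]; ring

lemma exp_neg_two_le_pow_mul_exp {x : ℝ} (hL : 10 / 11 ≤ L) (hLx : L ≤ x) (hxL : x ≤ L + 1)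
    {k : ℕ} (hk : (k : ℝ) = x) : Real.exp (-2) ≤ (L / x) ^ k * Real.exp (x - L) := by
  have hL0 : 0 < L := by linarith
  have hx0 : 0 < x := by linarith
  calc Real.exp (-2) ≤ Real.exp (1 - (L / x)⁻¹) ^ k * Real.exp (x - L) := by
        rw [← Real.exp_nat_mul, ← Real.exp_add, Real.exp_le_exp, hk, inv_div,
          show x * (1 - x / L) + (x - L) = -((x - L) ^ 2 / L) by field_simp; ring,
          neg_le_neg_iff, div_le_iff₀ hL0]
        nlinarith
    _ ≤ (L / x) ^ k * Real.exp (x - L) := by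
        gcongr; exact exp_one_sub_inv_le (by positivity)

lemma exp_neg_eight_le_poissonTail (hL : 10 / 11 ≤ L) {j : ℕ} (hj : j ≤ L) :
    Real.exp (-8) ≤ poissonTail L j := by
  have hL0 : 0 < L := by linarith
  have hs : 0 < √L := Real.sqrt_pos.2 hL0
  set x := ⌊L⌋₊ + 1 with hx
  have hLx : L ≤ x := by rw [hx, Nat.cast_succ]; exact (Nat.lt_floor_add_one L).le
  have hxL : (x : ℝ) ≤ L + 1 := by rw [hx, Nat.cast_succ]; linarith [Nat.floor_le hL0.le]
  have hdev : 1 + (x - L) / √L ≤ Real.exp 2 := by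
    have hsqrt : 1 / 2 ≤ √L := Real.le_sqrt_of_sq_le (by linarith)
    have : (x - L) / √L ≤ 2 := by rw [div_le_iff₀ hs]; linarith
    linarith [Real.add_one_le_exp 2]
  have hT := poissonTail_nonneg L x
  have hlower : Real.exp (-2) ≤ Real.exp 4 * Real.exp 2 * poissonTail L x :=
    calc Real.exp (-2) ≤ (L / x) ^ x * Real.exp (x - L) :=
          exp_neg_two_le_pow_mul_exp hL hLx hxL rfl
      _ ≤ Real.exp 4 * (1 + (x - L) / √L) * poissonTail L x :=
          pow_mul_exp_le_poissonTail hL0 hLx (by linarith)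
      _ ≤ Real.exp 4 * Real.exp 2 * poissonTail L x := by gcongr
  calc Real.exp (-8) = Real.exp (-6) * Real.exp (-2) := by rw [← Real.exp_add]; norm_num
    _ ≤ Real.exp (-6) * (Real.exp 4 * Real.exp 2 * poissonTail L x) := by gcongr
    _ = poissonTail L x := by
        simp only [← mul_assoc, ← Real.exp_add]; norm_num
    _ ≤ poissonTail L j := poissonTail_antitone L ((Nat.le_floor hj).trans (Nat.le_succ _))

lemma hasDerivAt_poissonWeight_zero (L : ℝ) :
    HasDerivAt (poissonWeight · 0) (-poissonWeight L 0) L := by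
  simpa [poissonWeight] using (hasDerivAt_neg L).exp

lemma hasDerivAt_poissonWeight_succ (L : ℝ) (k : ℕ) :
    HasDerivAt (poissonWeight · (k + 1)) (poissonWeight L k - poissonWeight L (k + 1)) L := by
  have h := (((hasDerivAt_neg L).exp).mul (hasDerivAt_pow (k + 1) L)).div_const
    ((k + 1).factorial : ℝ)
  refine h.congr_deriv ?_
  simp only [poissonWeight, Nat.factorial_succ]
  push_cast
  field_simp
  ring

lemma hasDerivAt_sum_poissonWeight (L : ℝ) (k : ℕ) :
    HasDerivAt (fun s ↦ ∑ i ∈ Finset.range (k + 1), poissonWeight s i) (-poissonWeight L k) L := by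
  induction k with
  | zero => simpa using hasDerivAt_poissonWeight_zero L
  | succ k ih =>
    simp only [Finset.sum_range_succ _ (k + 1)]
    exact (ih.add (hasDerivAt_poissonWeight_succ L k)).congr_deriv (by ring)

lemma hasDerivAt_poissonTail (hL : 0 < L) (k : ℕ) :
    HasDerivAt (poissonTail · (k + 1)) (poissonWeight L k) L := by
  have h := (hasDerivAt_sum_poissonWeight L k).const_sub 1
  rw [neg_neg] at h
  refine h.congr_of_eventuallyEq ?_
  filter_upwards [eventually_gt_nhds hL] with s hs
  rw [sum_poissonWeight_eq hs.le, sub_sub_cancel]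

lemma poissonTail_monotoneOn (x : ℕ) : MonotoneOn (poissonTail · x) (Set.Ioi 0) := by
  rcases x with _ | k
  · simpa only [poissonTail_zero] using monotoneOn_const
  · exact monotoneOn_of_hasDerivWithinAt_nonneg (convex_Ioi 0)
      (fun s hs ↦ (hasDerivAt_poissonTail hs k).continuousAt.continuousWithinAt)
      (fun s hs ↦ (hasDerivAt_poissonTail (interior_subset hs) k).hasDerivWithinAt)
      (fun s hs ↦ (poissonWeight_pos (interior_subset hs) k).le)

lemma poissonWeight_le_of_le {s : ℝ} (hs : 0 < s) (hsL : s ≤ L) {x : ℕ} (hx : L ≤ x) :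
    poissonWeight s x ≤ poissonWeight L x := by
  have hL : 0 < L := hs.trans_le hsL
  have hratio : (s / L) ^ x ≤ Real.exp (s - L) :=
    calc (s / L) ^ x ≤ Real.exp ((s - L) / L) ^ x := by
          gcongr
          have := Real.add_one_le_exp ((s - L) / L)
          rwa [show (s - L) / L + 1 = s / L by field_simp; ring] at this
      _ ≤ Real.exp (s - L) := by
          rw [← Real.exp_nat_mul, Real.exp_le_exp, ← mul_div_assoc, div_le_iff₀ hL]
          nlinarith
  rw [div_pow, div_le_iff₀ (by positivity)] at hratio
  unfold poissonWeight
  gcongr ?_ / _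
  calc Real.exp (-s) * s ^ x ≤ Real.exp (-s) * (Real.exp (s - L) * L ^ x) := by gcongr
    _ = Real.exp (-L) * L ^ x := by rw [← mul_assoc, ← Real.exp_add]; ring_nf

lemma poissonTail_sub_le {s : ℝ} (hs : 0 < s) (hsL : s ≤ L) {x : ℕ} (hx : L ≤ x) :
    poissonTail L x - poissonTail s x ≤ x / s * poissonWeight L x * (L - s) := by
  obtain ⟨k, rfl⟩ := Nat.exists_eq_succ_of_ne_zero
    (show x ≠ 0 by rintro rfl; simp at hx; linarith)
  have hderiv : ∀ u ∈ Set.Icc s L, HasDerivAt (poissonTail · (k + 1)) (poissonWeight u k) u :=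
    fun u hu ↦ hasDerivAt_poissonTail (hs.trans_le hu.1) k
  refine (convex_Icc s L).image_sub_le_mul_sub_of_deriv_le (f := (poissonTail · (k + 1)))
    (fun u hu ↦ (hderiv u hu).continuousAt.continuousWithinAt)
    (fun u hu ↦ (hderiv u (interior_subset hu)).differentiableAt.differentiableWithinAt)
    (fun u hu ↦ ?_) s ⟨le_rfl, hsL⟩ L ⟨hsL, le_rfl⟩ hsL
  have hu : u ∈ Set.Icc s L := interior_subset hu
  have hu0 : 0 < u := hs.trans_le hu.1
  calc deriv (poissonTail · (k + 1)) u = poissonWeight u k := (hderiv u hu).deriv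
    _ = (k + 1 : ℕ) / u * poissonWeight u (k + 1) := by
        rw [div_mul_eq_mul_div, eq_div_iff hu0.ne', Nat.cast_succ, succ_mul_poissonWeight_succ,
          mul_comm]
    _ ≤ (k + 1 : ℕ) / s * poissonWeight L (k + 1) := by
        have := (poissonWeight_pos hu0 (k + 1)).le
        gcongr
        · exact hu.1
        · exact poissonWeight_le_of_le hu0 hu.2 hx

lemma poissonWeight_tsub_le (hL : 0 < L) {j : ℕ} (hj : j ≤ 1.1 * L) {m : ℕ} (hm : m ≤ j) :
    poissonWeight L (j - m) ≤ 1.1 ^ m * poissonWeight L j := by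
  induction m with
  | zero => simp
  | succ m ih =>
    obtain ⟨i, hi⟩ : ∃ i, j = i + 1 + m := ⟨j - m - 1, by omega⟩
    have hji : (i : ℝ) + 1 ≤ 1.1 * L := le_trans (by exact_mod_cast (by omega : i + 1 ≤ j)) hj
    have hstep : poissonWeight L i ≤ 1.1 * poissonWeight L (i + 1) := by
      refine le_of_mul_le_mul_left ?_ hL
      rw [← succ_mul_poissonWeight_succ]
      nlinarith [poissonWeight_pos hL (i + 1)]
    have ih := ih (by omega)
    rw [show j - m = i + 1 by omega] at ih
    rw [show j - (m + 1) = i by omega, pow_succ]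
    linarith

lemma poissonTail_tsub_le (hL : 0 < L) {j : ℕ} (hj : j ≤ 1.1 * L) (m : ℕ) :
    poissonTail L (j - m) ≤ (11 * 1.1 ^ m - 10) * poissonTail L j := by
  induction m with
  | zero => norm_num
  | succ m ih =>
    have hT := poissonTail_nonneg L j
    rcases lt_or_ge m j with h | h
    · have hweight := poissonWeight_tsub_le hL hj (m := m + 1) h
      have hle : (1.1 : ℝ) ^ (m + 1) * poissonWeight L j ≤ 1.1 ^ (m + 1) * poissonTail L j := by
        gcongr
        exact poissonWeight_le_poissonTail hL.le j
      rw [poissonTail_eq_add_succ hL.le, show j - (m + 1) + 1 = j - m by omega]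
      rw [pow_succ] at hweight hle ⊢
      linarith
    · rw [show j - (m + 1) = j - m by omega]
      refine ih.trans ?_
      gcongr <;> norm_num

end Poisson

section PoissonShift

variable {N y u : ℝ} {x : ℕ}

lemma poissonTail_sub_poissonTail_shift_le (hN : 0 < N) (hy0 : 0 ≤ y) (hy : y ≤ 1 / 10)
    (hu0 : 0 ≤ u) (hu : u ≤ 1 / 10) (hx : (x : ℝ) = N * (1 + y)) :
    poissonTail N x - poissonTail (N * (1 - u)) x ≤
      10 * u * (√N * (1 + y * √N)) * poissonTail N x := by
  have hsqrt : √N * √N = N := Real.mul_self_sqrt hN.le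
  have hu1 : 0 < 1 - u := by linarith
  have hNx : N ≤ x := by rw [hx]; nlinarith
  have hT := poissonTail_nonneg N x
  have hweight : poissonWeight N x * √N ≤ Real.exp 2 * (1 + y * √N) * poissonTail N x := by
    have hdev : (x - N) / √N = y * √N := by
      rw [hx, div_eq_iff (Real.sqrt_pos.2 hN).ne', mul_assoc, hsqrt]
      ring
    simpa only [hdev] using poissonWeight_mul_sqrt_le hN hNx
  have hratio : x / (N * (1 - u)) ≤ 11 / 9 := by
    rw [div_le_iff₀ (mul_pos hN hu1), hx]
    nlinarith
  have hexp : Real.exp 2 ≤ 8 := by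
    have := Real.exp_one_lt_d9
    calc Real.exp 2 = Real.exp 1 ^ 2 := by rw [← Real.exp_nat_mul]; norm_num
      _ ≤ 2.8 ^ 2 := by gcongr; linarith
      _ ≤ 8 := by norm_num
  have hweight' : poissonWeight N x * √N ≤ 8 * (1 + y * √N) * poissonTail N x :=
    hweight.trans (by gcongr)
  calc poissonTail N x - poissonTail (N * (1 - u)) x
      ≤ x / (N * (1 - u)) * poissonWeight N x * (N - N * (1 - u)) :=
        poissonTail_sub_le (mul_pos hN hu1) (mul_le_of_le_one_right hN.le (by linarith)) hNx
    _ = x / (N * (1 - u)) * (poissonWeight N x * √N) * (√N * u) := by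
        linear_combination (-(x / (N * (1 - u)) * poissonWeight N x * u)) * hsqrt
    _ ≤ 11 / 9 * (8 * (1 + y * √N) * poissonTail N x) * (√N * u) := by
        have := (poissonWeight_pos hN x).le
        gcongr ?_ * ?_ * (√N * u)
    _ ≤ _ := by
        have : 0 ≤ u * (√N * (1 + y * √N)) * poissonTail N x := by positivity
        linarith

lemma inv_one_sub_pow_mul_exp_le (hu1 : u < 1) (hx : (x : ℝ) = N * (1 + y)) :
    ((1 - u)⁻¹) ^ x * Real.exp (-(N * u)) ≤ Real.exp (N * (u * (y + u) / (1 - u))) := by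
  have hpos : 0 < 1 - u := sub_pos.2 hu1
  have hinv : (1 - u)⁻¹ ≤ Real.exp (u / (1 - u)) := by
    calc (1 - u)⁻¹ = u / (1 - u) + 1 := by field_simp; ring
      _ ≤ _ := Real.add_one_le_exp _
  calc ((1 - u)⁻¹) ^ x * Real.exp (-(N * u))
      ≤ Real.exp (u / (1 - u)) ^ x * Real.exp (-(N * u)) := by gcongr
    _ = Real.exp (N * (u * (y + u) / (1 - u))) := by
        rw [← Real.exp_nat_mul, ← Real.exp_add, hx]
        congr 1
        field_simp
        ring

lemma one_add_sub_div_sqrt_shift_le (hN : 0 < N) (hy : y ≤ 1 / 10) (hu0 : 0 ≤ u)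
    (hu : u ≤ y / 2) (hx : (x : ℝ) = N * (1 + y)) :
    1 + (x - N * (1 - u)) / √(N * (1 - u)) ≤ 2 * (1 + y * √N) := by
  have hsqrt : 0.9 * √N ≤ √(N * (1 - u)) := by
    refine Real.le_sqrt_of_sq_le ?_
    rw [mul_pow, Real.sq_sqrt hN.le]
    nlinarith
  have hpos : 0 < √N := Real.sqrt_pos.2 hN
  have hdev : (x - N * (1 - u)) / √(N * (1 - u)) ≤ 2 * (y * √N) := by
    rw [div_le_iff₀ (by linarith)]
    calc x - N * (1 - u) = N * (y + u) := by rw [hx]; ring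
      _ ≤ N * (1.8 * y) := by gcongr; linarith
      _ = 2 * (y * √N) * (0.9 * √N) := by
          linear_combination (-1.8 * y) * Real.mul_self_sqrt hN.le
      _ ≤ _ := by
          have : 0 ≤ y := by linarith
          gcongr
  linarith

lemma exp_le_poissonTail_shift (hN : 0 < N) (hy : y ≤ 1 / 10) (hu0 : 0 ≤ u) (hu : u ≤ y / 2)
    (hx : (x : ℝ) = N * (1 + y)) :
    Real.exp (N * y) ≤ 2 * Real.exp 4 * (1 + y * √N) *
      Real.exp (N * (u * (y + u) / (1 - u))) * (poissonTail (N * (1 - u)) x * (1 + y) ^ x) := by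
  have hy0 : 0 ≤ y := by linarith
  have hu1 : 0 < 1 - u := by linarith
  have hL : 0 < N * (1 - u) := mul_pos hN hu1
  have hT := poissonTail_nonneg (N * (1 - u)) x
  have hlower : (N * (1 - u) / x) ^ x * Real.exp (x - N * (1 - u)) ≤
      Real.exp 4 * (2 * (1 + y * √N)) * poissonTail (N * (1 - u)) x := by
    refine (pow_mul_exp_le_poissonTail hL (by rw [hx]; nlinarith) (by rw [hx]; nlinarith)).trans ?_
    gcongr
    exact one_add_sub_div_sqrt_shift_le hN hy hu0 hu hx
  have hcancel : (N * (1 - u) / x) ^ x * ((1 - u)⁻¹) ^ x * (1 + y) ^ x = 1 := by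
    rw [← mul_pow, ← mul_pow, hx]
    field_simp
    exact one_pow x
  calc Real.exp (N * y) = Real.exp (x - N * (1 - u)) * Real.exp (-(N * u)) := by
        rw [← Real.exp_add, hx]
        congr 1
        ring
    _ = ((N * (1 - u) / x) ^ x * Real.exp (x - N * (1 - u))) *
          (((1 - u)⁻¹) ^ x * Real.exp (-(N * u))) * (1 + y) ^ x := by
        linear_combination (-(Real.exp (x - N * (1 - u)) * Real.exp (-(N * u)))) * hcancel
    _ ≤ (Real.exp 4 * (2 * (1 + y * √N)) * poissonTail (N * (1 - u)) x) *
          Real.exp (N * (u * (y + u) / (1 - u))) * (1 + y) ^ x := by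
        gcongr
        exact inv_one_sub_pow_mul_exp_le (by linarith) hx
    _ = _ := by ring

end PoissonShift

/-- The sequence `k ↦ P (Z < k) / P (Z = k - 1)` for a Poisson variable `Z` with parameter `L`,
from which the Stein–Chen solution is built. It is given by its recursion, so the value `1` at `0`
is a convention. -/
noncomputable def steinSeq (L : ℝ) : ℕ → ℝ
  | 0 => 1
  | k + 1 => 1 + k / L * steinSeq L k

/-- The increments of `steinSeq`, which govern the smoothness of the Stein–Chen solution below the
threshold. -/
noncomputable def steinIncr (L : ℝ) (k : ℕ) : ℝ := steinSeq L (k + 1) - steinSeq L k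

/-- The solution `g` of the Stein–Chen equation `k g(k) - L g(k + 1) = 1_{k ≥ x} - P (Z ≥ x)` for
a Poisson variable `Z` with parameter `L`; its sign is opposite to the usual one. -/
noncomputable def steinSol (L : ℝ) (x k : ℕ) : ℝ :=
  if k ≤ x then poissonTail L x * steinSeq L k / L
  else (1 - poissonTail L x) * poissonTail L k / (k * poissonWeight L k)

/-- A monotone majorant for `L` times the absolute increments of `steinSol L x`. -/
noncomputable def steinEnvelope (L : ℝ) (x k : ℕ) : ℝ :=
  if k < x then poissonTail L x * steinIncr L k else 2

section Stein

variable {L : ℝ}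

lemma steinSeq_succ (L : ℝ) (k : ℕ) : steinSeq L (k + 1) = 1 + k / L * steinSeq L k := rfl

lemma steinSeq_pos (hL : 0 < L) (k : ℕ) : 0 < steinSeq L k := by
  induction k with
  | zero => simp [steinSeq]
  | succ k ih => rw [steinSeq_succ]; positivity

lemma steinSeq_succ_mul_poissonWeight (hL : 0 < L) (k : ℕ) :
    steinSeq L (k + 1) * poissonWeight L k = 1 - poissonTail L (k + 1) := by
  induction k with
  | zero => simp [steinSeq, ← sum_poissonWeight_eq hL.le]
  | succ k ih =>
    calc steinSeq L (k + 1 + 1) * poissonWeight L (k + 1)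
        = poissonWeight L (k + 1) +
            steinSeq L (k + 1) / L * ((k + 1) * poissonWeight L (k + 1)) := by
          rw [steinSeq_succ]; push_cast; ring
      _ = poissonWeight L (k + 1) + steinSeq L (k + 1) * poissonWeight L k := by
          rw [succ_mul_poissonWeight_succ]; field_simp
      _ = 1 - poissonTail L (k + 1 + 1) := by rw [ih, poissonTail_eq_add_succ hL.le (k + 1)]; ring

lemma steinSeq_eq (hL : 0 < L) {k : ℕ} (hk : k ≠ 0) :
    steinSeq L k = L * (1 - poissonTail L k) / (k * poissonWeight L k) := by
  obtain ⟨m, rfl⟩ := Nat.exists_eq_succ_of_ne_zero hk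
  have hp := poissonWeight_pos hL m
  rw [Nat.cast_succ, succ_mul_poissonWeight_succ, ← steinSeq_succ_mul_poissonWeight hL]
  field_simp

lemma steinIncr_zero (L : ℝ) : steinIncr L 0 = 0 := by simp [steinIncr, steinSeq]

lemma steinIncr_succ (L : ℝ) (k : ℕ) :
    steinIncr L (k + 1) = (steinSeq L (k + 1) + k * steinIncr L k) / L := by
  simp only [steinIncr, steinSeq_succ L (k + 1), steinSeq_succ L k]
  push_cast
  ring

lemma steinIncr_nonneg (hL : 0 < L) (k : ℕ) : 0 ≤ steinIncr L k := by
  induction k with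
  | zero => exact (steinIncr_zero L).ge
  | succ k ih =>
    have := steinSeq_pos hL (k + 1)
    rw [steinIncr_succ]
    positivity

lemma steinSeq_monotone (hL : 0 < L) : Monotone (steinSeq L) :=
  monotone_nat_of_le_succ fun k ↦ sub_nonneg.1 (steinIncr_nonneg hL k)

lemma steinIncr_monotone (hL : 0 < L) : Monotone (steinIncr L) := by
  refine monotone_nat_of_le_succ fun k ↦ ?_
  induction k with
  | zero => rw [steinIncr_zero]; exact steinIncr_nonneg hL 1
  | succ k ih =>
    have hseq := steinSeq_monotone hL (k + 1).le_succ
    have hincr := steinIncr_nonneg hL k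
    rw [steinIncr_succ L k, steinIncr_succ L (k + 1)]
    gcongr
    exact k.le_succ

lemma steinIncr_eq_add (hL : 0 < L) {k : ℕ} (hk : k ≠ 0) :
    steinIncr L k = 1 + (1 - poissonTail L k) * ((k - L) / (k * poissonWeight L k)) := by
  have hp := poissonWeight_pos hL k
  have : (0 : ℝ) < k := by positivity
  rw [steinIncr, steinSeq_succ, steinSeq_eq hL hk]
  field_simp
  ring

lemma steinIncr_mul_poissonWeight_le (hL : 0 < L) (k : ℕ) :
    steinIncr L k * poissonWeight L k ≤ poissonWeight L k + max (k - L) 0 / L := by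
  have hp := poissonWeight_pos hL k
  rcases eq_or_ne k 0 with rfl | hk
  · rw [steinIncr_zero, zero_mul]; positivity
  have hk' : (0 : ℝ) < k := by positivity
  have heq : steinIncr L k * poissonWeight L k =
      poissonWeight L k + (1 - poissonTail L k) * ((k - L) / k) := by
    rw [steinIncr_eq_add hL hk]; field_simp
  have hF0 : 0 ≤ 1 - poissonTail L k := sub_nonneg.2 (poissonTail_le_one L k)
  have hF1 : 1 - poissonTail L k ≤ 1 := sub_le_self _ (poissonTail_nonneg L k)
  rw [heq]
  gcongr
  rcases le_total (k : ℝ) L with hkL | hLk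
  · rw [max_eq_right (sub_nonpos.2 hkL), zero_div]
    exact mul_nonpos_of_nonneg_of_nonpos hF0
      (div_nonpos_of_nonpos_of_nonneg (sub_nonpos.2 hkL) hk'.le)
  · have hsub : 0 ≤ k - L := sub_nonneg.2 hLk
    rw [max_eq_left hsub]
    calc (1 - poissonTail L k) * ((k - L) / k) ≤ 1 * ((k - L) / L) := by gcongr
      _ = (k - L) / L := one_mul _

lemma poissonTail_mul_steinIncr_le_two (hL : 0 < L) {x : ℕ} (hx : L < x) :
    poissonTail L x * steinIncr L x ≤ 2 := by
  have hx0 : (0 : ℝ) < x := hL.trans hx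
  have hp := poissonWeight_pos hL x
  have hmills : (x - L) * poissonTail L x / (x * poissonWeight L x) ≤ 1 :=
    (div_le_one (by positivity)).2 (sub_mul_poissonTail_le hL x)
  have hF := sub_nonneg.2 (poissonTail_le_one L x)
  calc poissonTail L x * steinIncr L x
      = poissonTail L x +
          (1 - poissonTail L x) * ((x - L) * poissonTail L x / (x * poissonWeight L x)) := by
        rw [steinIncr_eq_add hL (by exact_mod_cast hx0.ne')]; ring
    _ ≤ poissonTail L x + (1 - poissonTail L x) * 1 := by gcongr
    _ ≤ 2 := by linarith

lemma steinSol_of_le {x k : ℕ} (h : k ≤ x) :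
    steinSol L x k = poissonTail L x * steinSeq L k / L := if_pos h

lemma steinSol_of_ge (hL : 0 < L) {x k : ℕ} (hx : x ≠ 0) (h : x ≤ k) :
    steinSol L x k = (1 - poissonTail L x) * poissonTail L k / (k * poissonWeight L k) := by
  rcases h.eq_or_lt with rfl | h
  · rw [steinSol_of_le le_rfl, steinSeq_eq hL hx]
    field_simp
  · exact if_neg h.not_ge

lemma steinSol_equation (hL : 0 < L) {x : ℕ} (hx : x ≠ 0) (k : ℕ) :
    k * steinSol L x k - L * steinSol L x (k + 1) =
      (if x ≤ k then 1 else 0) - poissonTail L x := by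
  rcases lt_or_ge k x with h | h
  · rw [steinSol_of_le h.le, steinSol_of_le h, if_neg h.not_ge, steinSeq_succ]
    field_simp
    ring
  · have hk : (0 : ℝ) < k := by exact_mod_cast (Nat.pos_of_ne_zero hx).trans_le h
    have hp := poissonWeight_pos hL k
    rw [steinSol_of_ge hL hx h, steinSol_of_ge hL hx (h.trans k.le_succ), if_pos h, Nat.cast_succ,
      succ_mul_poissonWeight_succ, poissonTail_eq_add_succ hL.le k]
    field_simp
    ring

lemma steinEnvelope_monotone (hL : 0 < L) {x : ℕ} (hx : L < x) :
    Monotone (steinEnvelope L x) := by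
  intro i j hij
  have hT := poissonTail_nonneg L x
  unfold steinEnvelope
  split_ifs with hi hj hj
  · exact mul_le_mul_of_nonneg_left (steinIncr_monotone hL hij) hT
  · exact (mul_le_mul_of_nonneg_left (steinIncr_monotone hL hi.le) hT).trans
      (poissonTail_mul_steinIncr_le_two hL hx)
  · omega
  · exact le_rfl

lemma steinEnvelope_nonneg (hL : 0 < L) (x k : ℕ) : 0 ≤ steinEnvelope L x k := by
  unfold steinEnvelope
  split_ifs
  · exact mul_nonneg (poissonTail_nonneg L x) (steinIncr_nonneg hL k)
  · exact zero_le_two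

lemma steinEnvelope_of_ge {x k : ℕ} (h : x ≤ k) : steinEnvelope L x k = 2 := if_neg h.not_gt

lemma abs_steinSol_succ_sub_le_of_lt (hL : 0 < L) {x k : ℕ} (h : k < x) :
    |steinSol L x (k + 1) - steinSol L x k| ≤ steinEnvelope L x k / L := by
  have hT := poissonTail_nonneg L x
  have hincr := steinIncr_nonneg hL k
  rw [steinSol_of_le h.le, steinSol_of_le h, steinEnvelope, if_pos h, ← sub_div, ← mul_sub]
  exact (abs_of_nonneg (div_nonneg (mul_nonneg hT hincr) hL.le)).le

lemma abs_steinSol_succ_sub_le_of_ge (hL : 0 < L) {x k : ℕ} (hx : L < x) (h : x ≤ k) :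
    |steinSol L x (k + 1) - steinSol L x k| ≤ steinEnvelope L x k / L := by
  have hx0 : x ≠ 0 := by exact_mod_cast (hL.trans hx).ne'
  have hxk : (x : ℝ) ≤ k := by exact_mod_cast h
  have hk : (0 : ℝ) < k := by linarith
  have hp := poissonWeight_pos hL k
  have hF0 : 0 ≤ 1 - poissonTail L x := sub_nonneg.2 (poissonTail_le_one L x)
  have hF1 : 1 - poissonTail L x ≤ 1 := sub_le_self _ (poissonTail_nonneg L x)
  set u := (k - L) * poissonTail L k / (k * poissonWeight L k) with hu
  have hu0 : 0 ≤ u :=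
    div_nonneg (mul_nonneg (by linarith) (poissonTail_nonneg L k)) (by positivity)
  have hu1 : u ≤ 1 := (div_le_one (by positivity)).2 (sub_mul_poissonTail_le hL k)
  have heq : steinSol L x (k + 1) - steinSol L x k = -((1 - poissonTail L x) * (1 - u) / L) := by
    rw [steinSol_of_ge hL hx0 h, steinSol_of_ge hL hx0 (h.trans k.le_succ), hu, Nat.cast_succ,
      succ_mul_poissonWeight_succ, poissonTail_eq_add_succ hL.le k]
    field_simp
    ring
  rw [heq, abs_neg, abs_of_nonneg (div_nonneg (mul_nonneg hF0 (sub_nonneg.2 hu1)) hL.le),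
    steinEnvelope_of_ge h]
  gcongr
  nlinarith

lemma abs_steinSol_sub_le (hL : 0 < L) {x : ℕ} (hx : L < x) {a b c : ℕ} (hab : a ≤ b)
    (hbc : b ≤ c + 1) :
    |steinSol L x b - steinSol L x a| ≤ (b - a) * (steinEnvelope L x c / L) := by
  induction b, hab using Nat.le_induction with
  | base => simp
  | succ b _ ih =>
    have hstep : |steinSol L x (b + 1) - steinSol L x b| ≤ steinEnvelope L x c / L :=
      calc _ ≤ steinEnvelope L x b / L :=
            (lt_or_ge b x).elim (abs_steinSol_succ_sub_le_of_lt hL)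
              (abs_steinSol_succ_sub_le_of_ge hL hx)
        _ ≤ steinEnvelope L x c / L := by
            gcongr; exact steinEnvelope_monotone hL hx (Nat.le_of_succ_le_succ hbc)
    have htri := abs_sub_le (steinSol L x (b + 1)) (steinSol L x b) (steinSol L x a)
    rw [Nat.cast_succ]
    linarith [ih (b.le_succ.trans hbc)]

lemma sum_max_sub_le (L : ℝ) (x : ℕ) :
    ∑ j ∈ Finset.range x, max ((j : ℝ) - L) 0 ≤ max ((x : ℝ) - L) 0 ^ 2 := by
  induction x with
  | zero => simp
  | succ x ih =>
    have hstep : max ((x : ℝ) - L) 0 ^ 2 + max ((x : ℝ) - L) 0 ≤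
        max (((x + 1 : ℕ) : ℝ) - L) 0 ^ 2 := by
      push_cast
      rcases le_total (x : ℝ) L with h | h
      · rw [max_eq_right (sub_nonpos.2 h)]; simp
      · rw [max_eq_left (by linarith), max_eq_left (by linarith)]; nlinarith
    rw [Finset.sum_range_succ]
    linarith

lemma sum_steinEnvelope_mul_poissonWeight_le (hL : 0 < L) {x : ℕ} (hx : L < x) :
    ∑ j ∈ Finset.range x, steinEnvelope L x j * poissonWeight L j +
      steinEnvelope L x x * poissonTail L x ≤ poissonTail L x * (3 + (x - L) ^ 2 / L) := by
  have hT := poissonTail_nonneg L x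
  have hweights : ∑ j ∈ Finset.range x, poissonWeight L j ≤ 1 := by
    rw [sum_poissonWeight_eq hL.le]; linarith
  have hsum : ∑ j ∈ Finset.range x, steinEnvelope L x j * poissonWeight L j ≤
      poissonTail L x * (1 + (x - L) ^ 2 / L) :=
    calc ∑ j ∈ Finset.range x, steinEnvelope L x j * poissonWeight L j
        ≤ ∑ j ∈ Finset.range x, poissonTail L x * (poissonWeight L j + max (j - L) 0 / L) := by
          refine Finset.sum_le_sum fun j hj ↦ ?_
          rw [steinEnvelope, if_pos (Finset.mem_range.1 hj), mul_assoc]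
          exact mul_le_mul_of_nonneg_left (steinIncr_mul_poissonWeight_le hL j) hT
      _ = poissonTail L x * (∑ j ∈ Finset.range x, poissonWeight L j +
            (∑ j ∈ Finset.range x, max (j - L) 0) / L) := by
          rw [← Finset.mul_sum, Finset.sum_add_distrib, Finset.sum_div]
      _ ≤ poissonTail L x * (1 + (x - L) ^ 2 / L) := by
          have hmax := sum_max_sub_le L x
          rw [max_eq_left (sub_pos.2 hx).le] at hmax
          gcongr
  rw [steinEnvelope_of_ge le_rfl]
  linarith

end Stein

section LayerCake

variable {Ω : Type*} [MeasurableSpace Ω] {μ : Measure Ω} [IsProbabilityMeasure μ]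

lemma apply_min_eq_add_sum (β : ℕ → ℝ) (v m : ℕ) :
    β (min v m) = β 0 +
      ∑ j ∈ Finset.range m, (β (j + 1) - β j) * (Set.Ici (j + 1)).indicator 1 v := by
  induction m with
  | zero => simp
  | succ m ih =>
    rw [Finset.sum_range_succ, ← add_assoc, ← ih]
    by_cases h : m + 1 ≤ v
    · rw [min_eq_right h, min_eq_right (by omega), Set.indicator_of_mem (Set.mem_Ici.2 h)]
      simp
    · rw [min_eq_left (by omega), min_eq_left (by omega),
        Set.indicator_of_notMem (by simpa using h)]
      simp

lemma add_sum_sub_mul_poissonTail {L : ℝ} (hL : 0 ≤ L) (β : ℕ → ℝ) (x : ℕ) :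
    β 0 + ∑ j ∈ Finset.range x, (β (j + 1) - β j) * poissonTail L (j + 1) =
      ∑ j ∈ Finset.range x, β j * poissonWeight L j + β x * poissonTail L x := by
  induction x with
  | zero => simp [poissonTail_zero]
  | succ x ih =>
    rw [Finset.sum_range_succ, Finset.sum_range_succ, ← add_assoc, ih,
      poissonTail_eq_add_succ hL x]
    ring

lemma integral_eq_add_sum_measureReal {β : ℕ → ℝ} {x : ℕ} (hconst : ∀ k, x ≤ k → β k = β x)
    {V : Ω → ℕ} (hV : Measurable V) :
    ∫ ω, β (V ω) ∂μ =
      β 0 + ∑ j ∈ Finset.range x, (β (j + 1) - β j) * μ.real {ω | j + 1 ≤ V ω} := by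
  have hmeas : ∀ j, MeasurableSet (V ⁻¹' Set.Ici (j + 1)) := fun j ↦ hV measurableSet_Ici
  have hint : ∀ j, Integrable (fun ω ↦ (Set.Ici (j + 1)).indicator (1 : ℕ → ℝ) (V ω)) μ :=
    fun j ↦ (integrable_const (1 : ℝ)).indicator (hmeas j)
  have hβ : ∀ ω, β (V ω) = β 0 +
      ∑ j ∈ Finset.range x, (β (j + 1) - β j) * (Set.Ici (j + 1)).indicator 1 (V ω) := by
    intro ω
    rw [← apply_min_eq_add_sum]
    rcases le_total (V ω) x with h | h
    · rw [min_eq_left h]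
    · rw [min_eq_right h, hconst _ h]
  simp_rw [hβ]
  rw [integral_add (integrable_const _) (integrable_finsetSum _ fun j _ ↦ (hint j).const_mul _),
    integral_const, integral_finsetSum _ fun j _ ↦ (hint j).const_mul _, probReal_univ, one_smul]
  congr 1
  refine Finset.sum_congr rfl fun j _ ↦ ?_
  rw [integral_const_mul]
  congr 1
  exact integral_indicator_one (hmeas j)

lemma integral_le_of_measureReal_le {L : ℝ} (hL : 0 ≤ L) {β : ℕ → ℝ} (hβ : Monotone β)
    (hβ0 : 0 ≤ β 0) {x : ℕ} (hconst : ∀ k, x ≤ k → β k = β x) {V : Ω → ℕ} (hV : Measurable V)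
    {R : ℝ} (hR : 1 ≤ R) (htail : ∀ j ≤ x, μ.real {ω | j ≤ V ω} ≤ R * poissonTail L j) :
    ∫ ω, β (V ω) ∂μ ≤
      R * (∑ j ∈ Finset.range x, β j * poissonWeight L j + β x * poissonTail L x) := by
  rw [integral_eq_add_sum_measureReal hconst hV, ← add_sum_sub_mul_poissonTail hL, mul_add,
    Finset.mul_sum]
  refine add_le_add (le_mul_of_one_le_left hβ0 hR) (Finset.sum_le_sum fun j hj ↦ ?_)
  calc (β (j + 1) - β j) * μ.real {ω | j + 1 ≤ V ω}
      ≤ (β (j + 1) - β j) * (R * poissonTail L (j + 1)) :=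
        mul_le_mul_of_nonneg_left (htail _ (Finset.mem_range.1 hj))
          (sub_nonneg.2 (hβ j.le_succ))
    _ = R * ((β (j + 1) - β j) * poissonTail L (j + 1)) := mul_left_comm _ _ _

end LayerCake

section Independence

variable {Ω : Type*} {mΩ : MeasurableSpace Ω} {μ : Measure Ω}

lemma memLp_top_comp_of_ae_le {V : Ω → ℕ} (hV : Measurable V) {B : ℕ}
    (hB : ∀ᵐ ω ∂μ, V ω ≤ B) (φ : ℕ → ℝ) : MemLp (fun ω ↦ φ (V ω)) ⊤ μ := by
  refine memLp_top_of_bound (Measurable.of_discrete.comp hV).aestronglyMeasurable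
    (∑ i ∈ Finset.range (B + 1), |φ i|) ?_
  filter_upwards [hB] with ω hω
  exact Finset.single_le_sum (f := fun i ↦ |φ i|) (fun i _ ↦ abs_nonneg _)
    (Finset.mem_range.2 (Nat.lt_succ_of_le hω))

lemma indep_sup_of_indep [IsProbabilityMeasure μ] {m₁ m₂ m₃ : MeasurableSpace Ω}
    (h₁ : m₁ ≤ mΩ) (h₂ : m₂ ≤ mΩ) (h₃ : m₃ ≤ mΩ) (h₁₂₃ : Indep m₁ (m₂ ⊔ m₃) μ)
    (h₂₃ : Indep m₂ m₃ μ) :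
    Indep m₂ (m₁ ⊔ m₃) μ := by
  let π : Set (Set Ω) := Set.image2 (· ∩ ·) {s | MeasurableSet[m₁] s} {s | MeasurableSet[m₃] s}
  have hπ : IsPiSystem π := by
    rintro _ ⟨a, ha, b, hb, rfl⟩ _ ⟨c, hc, d, hd, rfl⟩ -
    exact ⟨a ∩ c, ha.inter hc, b ∩ d, hb.inter hd, Set.inter_inter_inter_comm a c b d⟩
  have hgen : m₁ ⊔ m₃ = MeasurableSpace.generateFrom π := by
    refine le_antisymm (sup_le ?_ ?_) (MeasurableSpace.generateFrom_le ?_)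
    · exact fun a ha ↦ MeasurableSpace.measurableSet_generateFrom
        ⟨a, ha, Set.univ, MeasurableSet.univ, Set.inter_univ a⟩
    · exact fun b hb ↦ MeasurableSpace.measurableSet_generateFrom
        ⟨Set.univ, MeasurableSet.univ, b, hb, Set.univ_inter b⟩
    · rintro _ ⟨a, ha, b, hb, rfl⟩
      exact MeasurableSet.inter (le_sup_left (a := m₁) (b := m₃) a ha)
        (le_sup_right (a := m₁) (b := m₃) b hb)
  refine IndepSets.indep h₂ (sup_le h₁ h₃) (@MeasurableSpace.isPiSystem_measurableSet Ω m₂) hπ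
    (@MeasurableSpace.generateFrom_measurableSet Ω m₂).symm hgen ?_
  rw [IndepSets_iff]
  rintro s _ hs ⟨a, ha, b, hb, rfl⟩
  have hsb : MeasurableSet[m₂ ⊔ m₃] (s ∩ b) :=
    MeasurableSet.inter (le_sup_left (a := m₂) (b := m₃) s hs)
      (le_sup_right (a := m₂) (b := m₃) b hb)
  calc μ (s ∩ (a ∩ b)) = μ (a ∩ (s ∩ b)) := by rw [Set.inter_left_comm]
    _ = μ a * (μ s * μ b) := by
      rw [(Indep_iff _ _ _).1 h₁₂₃ a _ ha hsb, (Indep_iff _ _ _).1 h₂₃ s b hs hb]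
    _ = μ s * (μ a * μ b) := mul_left_comm _ _ _
    _ = μ s * μ (a ∩ b) := by
      rw [(Indep_iff _ _ _).1 h₁₂₃ a b ha (le_sup_right (a := m₂) (b := m₃) b hb)]

/-- The σ-algebra generated by the variables `Y j`, `j ∈ I`, in the form used by
`IsMDependent`. -/
abbrev sigmaOf (Y : ℕ → Ω → ℕ) (I : Set ℕ) : MeasurableSpace Ω :=
  ⨆ j ∈ I, MeasurableSpace.comap (Y j) inferInstance

/-- The sum of the variables `Y j` over a finite set `I` of indices, as a random variable. -/
def partialSum (Y : ℕ → Ω → ℕ) (I : Finset ℕ) (ω : Ω) : ℕ := ∑ j ∈ I, Y j ω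

variable {Y : ℕ → Ω → ℕ} {I J : Set ℕ}

lemma sigmaOf_mono (h : I ⊆ J) : sigmaOf Y I ≤ sigmaOf Y J := biSup_mono h

lemma sigmaOf_union : sigmaOf Y (I ∪ J) = sigmaOf Y I ⊔ sigmaOf Y J := iSup_union

lemma sigmaOf_le (hY : ∀ j, Measurable (Y j)) (I : Set ℕ) : sigmaOf Y I ≤ mΩ :=
  iSup₂_le fun j _ ↦ (hY j).comap_le

lemma measurable_sigmaOf {j : ℕ} (hj : j ∈ I) : Measurable[sigmaOf Y I] (Y j) :=
  (comap_measurable (Y j)).mono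
    (le_iSup₂ (f := fun j (_ : j ∈ I) ↦ MeasurableSpace.comap (Y j) inferInstance) j hj) le_rfl

lemma measurable_comp_sigmaOf {j : ℕ} (hj : j ∈ I) (φ : ℕ → ℝ) :
    Measurable[sigmaOf Y I] fun ω ↦ φ (Y j ω) :=
  Measurable.of_discrete.comp (measurable_sigmaOf hj)

lemma measurable_mul_sigmaOf {i j : ℕ} (hi : i ∈ I) (hj : j ∈ I) :
    Measurable[sigmaOf Y I] fun ω ↦ (Y i ω : ℝ) * Y j ω :=
  Measurable.fun_mul (m := sigmaOf Y I) (measurable_comp_sigmaOf hi fun m ↦ m)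
    (measurable_comp_sigmaOf hj fun m ↦ m)

lemma measurable_partialSum_sigmaOf {s : Finset ℕ} (hs : ↑s ⊆ I) :
    Measurable[sigmaOf Y I] (partialSum Y s) :=
  @Finset.measurable_fun_sum _ _ _ _ _ _ (sigmaOf Y I) Y s fun _ hj ↦ measurable_sigmaOf (hs hj)

lemma integral_mul_of_indep_sigmaOf (hY : ∀ j, Measurable (Y j))
    (hIJ : Indep (sigmaOf Y I) (sigmaOf Y J) μ) {u v : Ω → ℝ} (hu : Measurable[sigmaOf Y I] u)
    (hv : Measurable[sigmaOf Y J] v) :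
    ∫ ω, u ω * v ω ∂μ = (∫ ω, u ω ∂μ) * ∫ ω, v ω ∂μ := by
  have huv : IndepFun u v μ := by
    rw [IndepFun_iff_Indep]
    exact indep_of_indep_of_le_right (indep_of_indep_of_le_left hIJ hu.comap_le) hv.comap_le
  exact huv.integral_fun_mul_eq_mul_integral
    (hu.mono (sigmaOf_le hY I) le_rfl).aestronglyMeasurable
    (hv.mono (sigmaOf_le hY J) le_rfl).aestronglyMeasurable

end Independence

section Binomial

variable {e : ℝ}

lemma one_add_pow_sub_one_le (he : 0 ≤ e) (m : ℕ) : (1 + e) ^ m - 1 ≤ m * e * (1 + e) ^ m := by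
  induction m with
  | zero => simp
  | succ m ih =>
    have h1 : 1 ≤ (1 + e) ^ (m + 1) := one_le_pow₀ (by linarith)
    have h2 : (1 + e) * ((1 + e) ^ m - 1) ≤ (1 + e) * (m * e * (1 + e) ^ m) := by gcongr
    have h3 : e * 1 ≤ e * (1 + e) ^ (m + 1) := by gcongr
    rw [pow_succ'] at h3 ⊢
    push_cast
    linarith

lemma one_add_pow_sub_one_le_quadratic (he : 0 ≤ e) (m : ℕ) :
    (1 + e) ^ m - 1 ≤ m * e + m * (m - 1) / 2 * e ^ 2 * (1 + e) ^ m := by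
  induction m with
  | zero => simp
  | succ m ih =>
    have h1 : 1 ≤ (1 + e) ^ (m + 1) := one_le_pow₀ (by linarith)
    have h2 : (1 + e) * ((1 + e) ^ m - 1) ≤
        (1 + e) * (m * e + m * (m - 1) / 2 * e ^ 2 * (1 + e) ^ m) := by gcongr
    have h3 : (m : ℝ) * e ^ 2 * 1 ≤ m * e ^ 2 * (1 + e) ^ (m + 1) := by gcongr
    rw [pow_succ' (1 + e)] at h3 ⊢
    push_cast
    linarith

lemma natCast_mul_sub_one_nonneg (m : ℕ) : (0 : ℝ) ≤ (m : ℝ) * ((m : ℝ) - 1) := by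
  rcases m.eq_zero_or_pos with rfl | hm
  · simp
  · exact mul_nonneg m.cast_nonneg (sub_nonneg.2 (Nat.one_le_cast.2 hm))

-- With `D k = (1 + e) ^ k - 1`, the left side is
-- `(1 + e) ^ (m + a + b) + (1 + e) ^ (m + a) * D c + (1 + e) ^ m * ((1 + e) ^ a * D b * D c)`.
lemma one_add_pow_add_three_le (he : 0 ≤ e) {K a b c : ℕ} (ha : a ≤ K) (hb : b ≤ K) (hc : c ≤ K)
    (m : ℕ) :
    (1 + e) ^ (m + a + b + c) ≤ (1 + e) ^ (m + a + b) +
      (1 + e) ^ (m + a) * (c * e + c * (c - 1) * (e ^ 2 * (1 + e) ^ (3 * K) / 2)) +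
      (1 + e) ^ m * (b * c * (e ^ 2 * (1 + e) ^ (3 * K))) := by
  have he1 : 1 ≤ 1 + e := by linarith
  have hlin : ∀ {k : ℕ}, k ≤ K → (1 + e) ^ k - 1 ≤ k * e * (1 + e) ^ K := fun {k} hk ↦
    (one_add_pow_sub_one_le he k).trans (by gcongr)
  have hnonneg : ∀ k : ℕ, 0 ≤ (1 + e) ^ k - 1 := fun k ↦ sub_nonneg.2 (one_le_pow₀ he1)
  have hquad : (1 + e) ^ c - 1 ≤ c * e + c * (c - 1) * (e ^ 2 * (1 + e) ^ (3 * K) / 2) := by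
    have hc0 := natCast_mul_sub_one_nonneg c
    calc (1 + e) ^ c - 1 ≤ c * e + c * (c - 1) / 2 * e ^ 2 * (1 + e) ^ c :=
          one_add_pow_sub_one_le_quadratic he c
      _ ≤ c * e + c * (c - 1) / 2 * e ^ 2 * (1 + e) ^ (3 * K) := by
          gcongr
          omega
      _ = _ := by ring
  have hprod : (1 + e) ^ a * (((1 + e) ^ b - 1) * ((1 + e) ^ c - 1)) ≤
      b * c * (e ^ 2 * (1 + e) ^ (3 * K)) :=
    calc _ ≤ (1 + e) ^ K * ((b * e * (1 + e) ^ K) * (c * e * (1 + e) ^ K)) := by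
          gcongr
          exacts [mul_nonneg (hnonneg b) (hnonneg c), hnonneg c, hlin hb, hlin hc]
      _ = _ := by ring
  calc (1 + e) ^ (m + a + b + c)
      = (1 + e) ^ (m + a + b) + (1 + e) ^ (m + a) * ((1 + e) ^ c - 1) +
        (1 + e) ^ m * ((1 + e) ^ a * (((1 + e) ^ b - 1) * ((1 + e) ^ c - 1))) := by
        rw [pow_add, pow_add, pow_add]
        ring
    _ ≤ _ := by gcongr

end Binomial

/-- The relative error of the Poisson approximation at relative deviation `y`, up to a constant. -/
noncomputable def approxError (γ ν : ℝ) (n : ℕ) (y : ℝ) : ℝ := γ * (ν⁻¹ + n * y ^ 2)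

/-- The relative decrease of the Poisson parameter from `ν` to `lambdaStar ν y`. -/
noncomputable def paramShift (ν y : ℝ) : ℝ := ν / (1 - ν) * y

/-- The main term `exp (Λ* y) (1 + C₃ γ y²)ⁿ` of the expansion, with `C₃ = 6`. -/
noncomputable def mainTerm (γ ν : ℝ) (n : ℕ) (y : ℝ) : ℝ :=
  Real.exp (LambdaStar n ν y) * (1 + 6 * γ * y ^ 2) ^ n

section ApproxError

lemma approxError_nonneg {γ ν : ℝ} (hγ : 0 ≤ γ) (hν : 0 ≤ ν) (n : ℕ) (y : ℝ) :
    0 ≤ approxError γ ν n y := by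
  unfold approxError
  positivity

lemma approxError_relDev_mono {γ ν : ℝ} (hγ : 0 ≤ γ) {n : ℕ} (hN : 0 < n * ν) {m x : ℕ}
    (hm : n * ν ≤ m) (hmx : m ≤ x) :
    approxError γ ν n (relDev n m ν) ≤ approxError γ ν n (relDev n x ν) := by
  have : 0 ≤ (m : ℝ) - n * ν := sub_nonneg.2 hm
  unfold approxError relDev
  gcongr

lemma relDev_eq {ν y : ℝ} {n x : ℕ} (hN : n * ν ≠ 0) (hx : (x : ℝ) = n * ν * (1 + y)) :
    relDev n x ν = y := by
  rw [relDev, hx, div_eq_iff hN]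
  ring

lemma natCast_eq_of_relDev {ν : ℝ} {n : ℕ} (hN : n * ν ≠ 0) (x : ℕ) :
    (x : ℝ) = n * ν * (1 + relDev n x ν) := by
  rw [relDev, mul_add, mul_div_cancel₀ _ hN]
  ring

end ApproxError

section MainTerm

variable {γ ν y : ℝ} {n : ℕ}

lemma mul_lambdaStar (n : ℕ) (ν y : ℝ) :
    n * lambdaStar ν y = n * ν * (1 - paramShift ν y) := by
  rw [lambdaStar, paramShift, mul_assoc]

lemma paramShift_nonneg (hν0 : 0 ≤ ν) (hν1 : ν ≤ 1) (hy0 : 0 ≤ y) : 0 ≤ paramShift ν y :=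
  mul_nonneg (div_nonneg hν0 (sub_nonneg.2 hν1)) hy0

lemma paramShift_le (hν0 : 0 ≤ ν) (hν : ν ≤ 1 / 100) (hy0 : 0 ≤ y) :
    paramShift ν y ≤ 1.02 * (ν * y) := by
  rw [paramShift, ← mul_assoc]
  gcongr
  rw [div_le_iff₀ (by linarith)]
  nlinarith

lemma LambdaStar_eq_tsum_paramShift (n : ℕ) (ν y : ℝ) :
    LambdaStar n ν y = n * ∑' j : ℕ, 1 / ((j + 2 : ℕ) : ℝ) * paramShift ν y ^ (j + 2) := by
  simp only [LambdaStar, paramShift, mul_pow, mul_assoc]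

lemma LambdaStar_nonneg (n : ℕ) (hu : 0 ≤ paramShift ν y) : 0 ≤ LambdaStar n ν y := by
  rw [LambdaStar_eq_tsum_paramShift]
  positivity

lemma LambdaStar_le (n : ℕ) (hu : 0 ≤ paramShift ν y) (hu' : paramShift ν y ≤ 1 / 2) :
    LambdaStar n ν y ≤ n * paramShift ν y ^ 2 := by
  rw [LambdaStar_eq_tsum_paramShift]
  set u := paramShift ν y
  have hsum : Summable fun j : ℕ ↦ u ^ 2 / 2 * u ^ j :=
    (summable_geometric_of_lt_one hu (by linarith)).mul_left _
  have hle (j : ℕ) : 1 / ((j + 2 : ℕ) : ℝ) * u ^ (j + 2) ≤ u ^ 2 / 2 * u ^ j := by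
    have hj : 1 / ((j + 2 : ℕ) : ℝ) ≤ 1 / 2 := by
      gcongr
      exact_mod_cast Nat.le_add_left 2 j
    calc 1 / ((j + 2 : ℕ) : ℝ) * u ^ (j + 2) ≤ 1 / 2 * u ^ (j + 2) := by gcongr
      _ = u ^ 2 / 2 * u ^ j := by ring
  have hinv : (1 - u)⁻¹ ≤ 2 := by
    rw [inv_le_comm₀ (by linarith) (by norm_num)]
    linarith
  gcongr
  calc ∑' j : ℕ, 1 / ((j + 2 : ℕ) : ℝ) * u ^ (j + 2) ≤ ∑' j : ℕ, u ^ 2 / 2 * u ^ j :=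
        (hsum.of_nonneg_of_le (fun j ↦ by positivity) hle).tsum_le_tsum hle hsum
    _ = u ^ 2 / 2 * (1 - u)⁻¹ := by
        rw [tsum_mul_left, tsum_geometric_of_lt_one hu (by linarith)]
    _ ≤ u ^ 2 / 2 * 2 := by gcongr
    _ = u ^ 2 := by ring

lemma one_le_mainTerm (hγ : 0 ≤ γ) (n : ℕ) (hu : 0 ≤ paramShift ν y) : 1 ≤ mainTerm γ ν n y :=
  one_le_mul_of_one_le_of_one_le (Real.one_le_exp (LambdaStar_nonneg n hu))
    (one_le_pow₀ (le_add_of_nonneg_right (by positivity)))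

lemma mainTerm_le_of_small (hγ : ν ^ 2 ≤ γ) (hν0 : 0 ≤ ν) (hν : ν ≤ 1 / 100) (hy0 : 0 ≤ y)
    (hy : y ≤ 1 / 10) (hsmall : 8 * approxError γ ν n y ≤ 1) :
    mainTerm γ ν n y ≤ 1 + 16 * approxError γ ν n y := by
  have hγ0 : 0 ≤ γ := (sq_nonneg ν).trans hγ
  have hε := approxError_nonneg hγ0 hν0 n y
  have hu0 := paramShift_nonneg hν0 (by linarith) hy0
  have hu := paramShift_le hν0 hν hy0
  have hw : n * (γ * y ^ 2) ≤ approxError γ ν n y := by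
    have : 0 ≤ γ * ν⁻¹ := by positivity
    rw [approxError]
    linarith
  have hΛ : LambdaStar n ν y ≤ 2 * approxError γ ν n y := by
    calc LambdaStar n ν y ≤ n * paramShift ν y ^ 2 := LambdaStar_le n hu0 (by nlinarith)
      _ ≤ n * (1.02 * (ν * y)) ^ 2 := by gcongr
      _ = 1.0404 * (n * (ν ^ 2 * y ^ 2)) := by ring
      _ ≤ 2 * (n * (γ * y ^ 2)) := by gcongr; norm_num
      _ ≤ _ := by gcongr
  have hpow : (1 + 6 * γ * y ^ 2) ^ n ≤ Real.exp (6 * approxError γ ν n y) := by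
    calc (1 + 6 * γ * y ^ 2) ^ n ≤ Real.exp (6 * γ * y ^ 2) ^ n := by
          gcongr
          rw [add_comm]
          exact Real.add_one_le_exp _
      _ = Real.exp (6 * (n * (γ * y ^ 2))) := by rw [← Real.exp_nat_mul]; ring_nf
      _ ≤ _ := by gcongr
  have hexp := Real.abs_exp_sub_one_le (x := 8 * approxError γ ν n y)
    (by rwa [abs_of_nonneg (by positivity)])
  rw [abs_of_nonneg (by positivity : (0 : ℝ) ≤ 8 * approxError γ ν n y)] at hexp
  calc mainTerm γ ν n y
      ≤ Real.exp (2 * approxError γ ν n y) * Real.exp (6 * approxError γ ν n y) := by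
        unfold mainTerm
        gcongr
    _ = Real.exp (8 * approxError γ ν n y) := by rw [← Real.exp_add]; ring_nf
    _ ≤ 1 + 16 * approxError γ ν n y := by linarith [le_of_abs_le hexp]

lemma exp_pow_mul_le_mainTerm (hγ : ν ^ 2 ≤ γ) (hν0 : 0 ≤ ν) (hν : ν ≤ 1 / 100) (hy0 : 0 ≤ y)
    (hy : y ≤ 1 / 10) :
    Real.exp (2 * (ν * y) ^ 2) ^ n * (1 + 3 / 2 * γ * y ^ 2) ^ n ≤ mainTerm γ ν n y := by
  have hγ0 : 0 ≤ γ := (sq_nonneg ν).trans hγ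
  have hνy : ν * y ≤ 1 / 100 * (1 / 10) := mul_le_mul hν hy hy0 (by norm_num)
  have ha : (ν * y) ^ 2 ≤ 1 / 100 := by nlinarith [mul_nonneg hν0 hy0]
  have haw : (ν * y) ^ 2 ≤ γ * y ^ 2 := by
    rw [mul_pow]
    gcongr
  have hexp : Real.exp (2 * (ν * y) ^ 2) ≤ 1 + 4 * (ν * y) ^ 2 := by
    have hpos : 0 ≤ 2 * (ν * y) ^ 2 := by positivity
    have := Real.abs_exp_sub_one_le (x := 2 * (ν * y) ^ 2)
      (by rw [abs_of_nonneg hpos]; linarith)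
    rw [abs_of_nonneg hpos] at this
    linarith [le_of_abs_le this]
  calc Real.exp (2 * (ν * y) ^ 2) ^ n * (1 + 3 / 2 * γ * y ^ 2) ^ n
      ≤ ((1 + 4 * (ν * y) ^ 2) * (1 + 3 / 2 * γ * y ^ 2)) ^ n := by
        rw [← mul_pow]
        gcongr
    _ ≤ (1 + 6 * γ * y ^ 2) ^ n := by
        gcongr
        have hw : 0 ≤ γ * y ^ 2 := by positivity
        have : (ν * y) ^ 2 * (γ * y ^ 2) ≤ 1 / 100 * (γ * y ^ 2) := by gcongr
        linarith
    _ ≤ mainTerm γ ν n y :=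
        le_mul_of_one_le_left (by positivity) (Real.one_le_exp
          (LambdaStar_nonneg n (paramShift_nonneg hν0 (by linarith) hy0)))

lemma poissonTail_sub_poissonTail_lambdaStar_le {x : ℕ} (hγ : ν ^ 2 ≤ γ) (hN : 0 < n * ν)
    (hν0 : 0 < ν) (hν : ν ≤ 1 / 100) (hy0 : 0 ≤ y) (hy : y ≤ 1 / 10)
    (hx : (x : ℝ) = n * ν * (1 + y)) :
    poissonTail (n * ν) x - poissonTail (n * lambdaStar ν y) x ≤
      16 * approxError γ ν n y * poissonTail (n * ν) x := by
  have hu0 := paramShift_nonneg hν0.le (by linarith) hy0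
  have hu := paramShift_le hν0.le hν hy0
  have hT := poissonTail_nonneg (n * ν) x
  rw [mul_lambdaStar]
  refine (poissonTail_sub_poissonTail_shift_le hN hy0 hy hu0 (by nlinarith) hx).trans ?_
  refine mul_le_mul_of_nonneg_right ?_ hT
  set t : ℝ := y * √(n * ν)
  have ht : t ^ 2 = n * ν * y ^ 2 := by rw [mul_pow, Real.sq_sqrt hN.le, mul_comm]
  calc 10 * paramShift ν y * (√(n * ν) * (1 + t))
      ≤ 10 * (1.02 * (ν * y)) * (√(n * ν) * (1 + t)) := by gcongr
    _ = 10.2 * ν * (t + t ^ 2) := by ring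
    _ ≤ 10.2 * ν * (3 / 2 * (1 + t ^ 2)) := by
        gcongr
        linarith [sq_nonneg (t - 1)]
    _ = 15.3 * (ν ^ 2 * (ν⁻¹ + n * y ^ 2)) := by
        rw [ht]
        field_simp
        norm_num
    _ ≤ 16 * approxError γ ν n y := by
        unfold approxError
        gcongr
        norm_num

end MainTerm

/-- A one-dependent sequence of natural-number-valued variables bounded by `K`, of which only the
`n` terms with indices `2, …, n + 1` may be nonzero; those terms have mean `ν`, and `δ` bounds all
second-order moments. The zero padding gives every term two neighbours on each side. -/
structure IsPaddedOneDependent {Ω : Type*} [MeasurableSpace Ω] (μ : Measure Ω) (Y : ℕ → Ω → ℕ)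
    (n K : ℕ) (ν δ : ℝ) : Prop where
  measurable : ∀ j, Measurable (Y j)
  ae_le : ∀ j, ∀ᵐ ω ∂μ, Y j ω ≤ K
  indep : ∀ s, Indep (sigmaOf Y (Set.Iio s)) (sigmaOf Y (Set.Ioi s)) μ
  eq_zero_of_lt : ∀ j < 2, Y j = 0
  eq_zero_of_ge : ∀ j, n + 2 ≤ j → Y j = 0
  factMoment1_eq : ∀ k < n, factMoment1 (Y (k + 2)) μ = ν
  factMoment1_le : ∀ j, factMoment1 (Y j) μ ≤ ν
  factMoment2_le : ∀ j, factMoment2 (Y j) μ ≤ δ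
  mixedMoment_le : ∀ j, mixedMoment (Y j) (Y (j + 1)) μ ≤ δ
  sq_le : ν ^ 2 ≤ δ

namespace IsPaddedOneDependent

variable {Ω : Type*} {mΩ : MeasurableSpace Ω} {μ : Measure Ω} {Y : ℕ → Ω → ℕ} {n K : ℕ} {ν δ e : ℝ}

lemma nonneg_mean (h : IsPaddedOneDependent μ Y n K ν δ) : 0 ≤ ν :=
  (integral_nonneg fun ω ↦ (Y 0 ω).cast_nonneg).trans (h.factMoment1_le 0)

lemma nonneg_secondMoment (h : IsPaddedOneDependent μ Y n K ν δ) : 0 ≤ δ :=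
  (sq_nonneg ν).trans h.sq_le

lemma measurable_partialSum (h : IsPaddedOneDependent μ Y n K ν δ) (s : Finset ℕ) :
    Measurable (partialSum Y s) :=
  Finset.measurable_fun_sum s fun j _ ↦ h.measurable j

lemma ae_partialSum_le (h : IsPaddedOneDependent μ Y n K ν δ) (s : Finset ℕ) :
    ∀ᵐ ω ∂μ, partialSum Y s ω ≤ s.card * K := by
  filter_upwards [ae_all_iff.2 h.ae_le] with ω hω
  simpa [partialSum] using Finset.sum_le_card_nsmul s (fun j ↦ Y j ω) K fun j _ ↦ hω j

lemma memLp_comp (h : IsPaddedOneDependent μ Y n K ν δ) (j : ℕ) (φ : ℕ → ℝ) :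
    MemLp (fun ω ↦ φ (Y j ω)) ⊤ μ :=
  memLp_top_comp_of_ae_le (h.measurable j) (h.ae_le j) φ

lemma memLp_comp_partialSum (h : IsPaddedOneDependent μ Y n K ν δ) (s : Finset ℕ) (φ : ℕ → ℝ) :
    MemLp (fun ω ↦ φ (partialSum Y s ω)) ⊤ μ :=
  memLp_top_comp_of_ae_le (h.measurable_partialSum s) (h.ae_partialSum_le s) φ

lemma memLp_mul (h : IsPaddedOneDependent μ Y n K ν δ) (i j : ℕ) :
    MemLp (fun ω ↦ (Y i ω : ℝ) * Y j ω) ⊤ μ :=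
  (h.memLp_comp j fun m ↦ m).mul' (h.memLp_comp i fun m ↦ m)

lemma partialSum_range_add_four (h : IsPaddedOneDependent μ Y n K ν δ) :
    partialSum Y (Finset.range (n + 4)) = partialSum Y (Finset.range (n + 2)) := by
  funext ω
  simp only [partialSum]
  rw [Finset.sum_range_succ, Finset.sum_range_succ, h.eq_zero_of_ge (n + 2) le_rfl,
    h.eq_zero_of_ge (n + 2 + 1) (by omega)]
  rfl

lemma integral_comp_partialSum_mul (h : IsPaddedOneDependent μ Y n K ν δ) (j : ℕ) (φ : ℕ → ℝ)
    {v : Ω → ℝ} (hv : Measurable[sigmaOf Y (Set.Ioi j)] v) :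
    ∫ ω, φ (partialSum Y (Finset.range j) ω) * v ω ∂μ =
      (∫ ω, φ (partialSum Y (Finset.range j) ω) ∂μ) * ∫ ω, v ω ∂μ :=
  integral_mul_of_indep_sigmaOf h.measurable (h.indep j)
    ((Measurable.of_discrete (f := φ)).comp (measurable_partialSum_sigmaOf (by simp))) hv

section Chernoff

lemma integral_linear_add_quadratic_le [IsFiniteMeasure μ] (h : IsPaddedOneDependent μ Y n K ν δ)
    {p q : ℝ} (hp : 0 ≤ p) (hq : 0 ≤ q) (j : ℕ) :
    ∫ ω, (Y j ω * p + Y j ω * ((Y j ω : ℝ) - 1) * q) ∂μ ≤ ν * p + δ * q := by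
  rw [integral_add ((h.memLp_comp j fun m ↦ m * p).integrable le_top)
    ((h.memLp_comp j fun m ↦ m * (m - 1) * q).integrable le_top), integral_mul_const,
    integral_mul_const]
  exact add_le_add (mul_le_mul_of_nonneg_right (h.factMoment1_le j) hp)
    (mul_le_mul_of_nonneg_right (h.factMoment2_le j) hq)

lemma integral_one_add_pow_le_three_terms [IsFiniteMeasure μ]
    (h : IsPaddedOneDependent μ Y n K ν δ) (he : 0 ≤ e) (j : ℕ) :
    ∫ ω, (1 + e) ^ partialSum Y (Finset.range (j + 3)) ω ∂μ ≤
      ∫ ω, (1 + e) ^ partialSum Y (Finset.range (j + 2)) ω ∂μ +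
      (∫ ω, (1 + e) ^ partialSum Y (Finset.range (j + 1)) ω ∂μ) *
        (ν * e + δ * (e ^ 2 * (1 + e) ^ (3 * K) / 2)) +
      (∫ ω, (1 + e) ^ partialSum Y (Finset.range j) ω ∂μ) *
        (δ * (e ^ 2 * (1 + e) ^ (3 * K))) := by
  set D := e ^ 2 * (1 + e) ^ (3 * K)
  have hD : 0 ≤ D := by positivity
  let p : ℕ → Ω → ℝ := fun k ω ↦ (1 + e) ^ partialSum Y (Finset.range k) ω
  let φ : ℕ → ℝ := fun m ↦ m * e + m * (m - 1) * (D / 2)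
  let q : Ω → ℝ := fun ω ↦ φ (Y (j + 2) ω)
  let r : Ω → ℝ := fun ω ↦ Y (j + 1) ω * Y (j + 2) ω
  have hpL : ∀ k, MemLp (p k) ⊤ μ := fun k ↦ h.memLp_comp_partialSum _ fun m ↦ (1 + e) ^ m
  have hp0 : ∀ k, 0 ≤ ∫ ω, p k ω ∂μ := fun k ↦ integral_nonneg fun ω ↦ by positivity
  have hi₁ : Integrable (fun ω ↦ p (j + 1) ω * q ω) μ :=
    ((h.memLp_comp (j + 2) φ).mul' (hpL (j + 1)) (r := ⊤)).integrable le_top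
  have hi₀ : Integrable (fun ω ↦ p j ω * r ω * D) μ :=
    (((h.memLp_mul (j + 1) (j + 2)).mul' (hpL j) (r := ⊤)).integrable le_top).mul_const D
  have hpq : ∫ ω, p (j + 1) ω * q ω ∂μ = (∫ ω, p (j + 1) ω ∂μ) * ∫ ω, q ω ∂μ :=
    h.integral_comp_partialSum_mul (j + 1) (fun m ↦ (1 + e) ^ m)
      (measurable_comp_sigmaOf (Set.mem_Ioi.2 (j + 1).lt_succ_self) φ)
  have hpr : ∫ ω, p j ω * r ω ∂μ = (∫ ω, p j ω ∂μ) * ∫ ω, r ω ∂μ :=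
    h.integral_comp_partialSum_mul j (fun m ↦ (1 + e) ^ m) (measurable_mul_sigmaOf
      (Set.mem_Ioi.2 j.lt_succ_self) (Set.mem_Ioi.2 (Nat.lt_add_of_pos_right Nat.two_pos)))
  have hpt : ∀ᵐ ω ∂μ, p (j + 3) ω ≤ p (j + 2) ω + p (j + 1) ω * q ω + p j ω * r ω * D := by
    filter_upwards [h.ae_le j, h.ae_le (j + 1), h.ae_le (j + 2)] with ω ha hb hc
    simpa only [p, q, r, φ, partialSum, Finset.sum_range_succ, mul_assoc] using
      one_add_pow_add_three_le he ha hb hc (∑ i ∈ Finset.range j, Y i ω)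
  have hi₂ : Integrable (fun ω ↦ p (j + 2) ω) μ := (hpL _).integrable le_top
  have hi₂₁ : Integrable (fun ω ↦ p (j + 2) ω + p (j + 1) ω * q ω) μ := hi₂.add hi₁
  refine (integral_mono_ae ((hpL (j + 3)).integrable le_top) (hi₂₁.add hi₀) hpt).trans ?_
  simp only [Pi.add_apply]
  rw [integral_add hi₂₁ hi₀, integral_add hi₂ hi₁, integral_mul_const, hpq, hpr, mul_assoc]
  refine add_le_add (add_le_add le_rfl (mul_le_mul_of_nonneg_left ?_ (hp0 _)))
    (mul_le_mul_of_nonneg_left ?_ (hp0 _))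
  · exact h.integral_linear_add_quadratic_le he (by positivity) (j + 2)
  · exact mul_le_mul_of_nonneg_right (h.mixedMoment_le (j + 1)) hD

lemma integral_one_add_pow_mono [IsFiniteMeasure μ] (h : IsPaddedOneDependent μ Y n K ν δ)
    (he : 0 ≤ e) :
    Monotone fun k ↦ ∫ ω, (1 + e) ^ partialSum Y (Finset.range k) ω ∂μ := by
  intro k l hkl
  refine integral_mono ((h.memLp_comp_partialSum _ fun m ↦ (1 + e) ^ m).integrable le_top)
    ((h.memLp_comp_partialSum _ fun m ↦ (1 + e) ^ m).integrable le_top) fun ω ↦ ?_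
  exact pow_le_pow_right₀ (by linarith)
    (Finset.sum_le_sum_of_subset (Finset.range_mono hkl))

lemma integral_one_add_pow_succ_le [IsFiniteMeasure μ] (h : IsPaddedOneDependent μ Y n K ν δ)
    (he : 0 ≤ e) (j : ℕ) :
    ∫ ω, (1 + e) ^ partialSum Y (Finset.range (j + 3)) ω ∂μ ≤
      (1 + ν * e + 3 / 2 * δ * e ^ 2 * (1 + e) ^ (3 * K)) *
        ∫ ω, (1 + e) ^ partialSum Y (Finset.range (j + 2)) ω ∂μ := by
  have hν := h.nonneg_mean
  have hδ := h.nonneg_secondMoment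
  have hmono := h.integral_one_add_pow_mono he
  have h₁ := hmono (Nat.le_succ (j + 1))
  have h₀ := hmono (show j ≤ j + 2 by omega)
  beta_reduce at h₀ h₁
  set P := ∫ ω, (1 + e) ^ partialSum Y (Finset.range (j + 2)) ω ∂μ
  calc _ ≤ _ := h.integral_one_add_pow_le_three_terms he j
    _ ≤ P + P * (ν * e + δ * (e ^ 2 * (1 + e) ^ (3 * K) / 2)) +
        P * (δ * (e ^ 2 * (1 + e) ^ (3 * K))) := by gcongr
    _ = _ := by ring

lemma integral_one_add_pow_le [IsProbabilityMeasure μ] (h : IsPaddedOneDependent μ Y n K ν δ)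
    (he : 0 ≤ e) (m : ℕ) :
    ∫ ω, (1 + e) ^ partialSum Y (Finset.range (m + 2)) ω ∂μ ≤
      (1 + ν * e + 3 / 2 * δ * e ^ 2 * (1 + e) ^ (3 * K)) ^ m := by
  have hν := h.nonneg_mean
  have hδ := h.nonneg_secondMoment
  induction m with
  | zero =>
    have hzero : ∀ ω, partialSum Y (Finset.range (0 + 2)) ω = 0 := fun ω ↦
      Finset.sum_eq_zero fun i hi ↦ congrFun (h.eq_zero_of_lt i (by simpa using hi)) ω
    simp [hzero]
  | succ m ih =>
    rw [pow_succ']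
    exact (h.integral_one_add_pow_succ_le he m).trans
      (mul_le_mul_of_nonneg_left ih (by positivity))

lemma measureReal_mul_one_add_pow_le [IsProbabilityMeasure μ]
    (h : IsPaddedOneDependent μ Y n K ν δ) (he : 0 ≤ e) (x : ℕ) :
    μ.real {ω | x ≤ partialSum Y (Finset.range (n + 4)) ω} * (1 + e) ^ x ≤
      (1 + ν * e + 3 / 2 * δ * e ^ 2 * (1 + e) ^ (3 * K)) ^ n := by
  rw [h.partialSum_range_add_four]
  refine le_trans ?_ (h.integral_one_add_pow_le he n)
  set S := partialSum Y (Finset.range (n + 2))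
  have hint : Integrable (fun ω ↦ (1 + e) ^ S ω) μ :=
    (h.memLp_comp_partialSum _ fun m ↦ (1 + e) ^ m).integrable le_top
  have hsub : {ω | x ≤ S ω} ⊆ {ω | (1 + e) ^ x ≤ (1 + e) ^ S ω} := fun ω hω ↦
    pow_le_pow_right₀ (le_add_of_nonneg_right he) hω
  calc _ ≤ (1 + e) ^ x * μ.real {ω | (1 + e) ^ x ≤ (1 + e) ^ S ω} := by
        rw [mul_comm]
        exact mul_le_mul_of_nonneg_left (measureReal_mono hsub) (by positivity)
    _ ≤ _ := mul_meas_ge_le_integral_of_nonneg (ae_of_all _ fun ω ↦ by positivity) hint _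

end Chernoff

end IsPaddedOneDependent

/-- The mean of the Stein envelope at the sum over all indices outside `[k, k + 4]`, increased by
the largest possible contribution `5 * K` of the omitted block. -/
noncomputable def meanEnvelope {Ω : Type*} [MeasurableSpace Ω] (μ : Measure Ω) (Y : ℕ → Ω → ℕ)
    (n K : ℕ) (L : ℝ) (x k : ℕ) : ℝ :=
  ∫ ω, steinEnvelope L x
    (partialSum Y (Finset.range (n + 4) \ Finset.Icc k (k + 4)) ω + 5 * K) ∂μ

namespace IsPaddedOneDependent

variable {Ω : Type*} {mΩ : MeasurableSpace Ω} {μ : Measure Ω}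
  {Y : ℕ → Ω → ℕ} {n K : ℕ} {ν δ L : ℝ}

lemma indep_Ioo [IsProbabilityMeasure μ] (h : IsPaddedOneDependent μ Y n K ν δ) {s t : ℕ}
    (hst : s ≤ t) :
    Indep (sigmaOf Y (Set.Ioo s t)) (sigmaOf Y (Set.Iio s ∪ Set.Ioi t)) μ := by
  have hpast : Indep (sigmaOf Y (Set.Iio s)) (sigmaOf Y (Set.Ioo s t) ⊔ sigmaOf Y (Set.Ioi t)) μ :=
    indep_of_indep_of_le_right (h.indep s) <| sup_le (sigmaOf_mono Set.Ioo_subset_Ioi_self)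
      (sigmaOf_mono (Set.Ioi_subset_Ioi hst))
  have hfuture : Indep (sigmaOf Y (Set.Ioo s t)) (sigmaOf Y (Set.Ioi t)) μ :=
    indep_of_indep_of_le_left (h.indep t) (sigmaOf_mono Set.Ioo_subset_Iio_self)
  rw [sigmaOf_union]
  exact indep_sup_of_indep (sigmaOf_le h.measurable _) (sigmaOf_le h.measurable _)
    (sigmaOf_le h.measurable _) hpast hfuture

lemma integral_mul_comp_partialSum_sdiff [IsProbabilityMeasure μ]
    (h : IsPaddedOneDependent μ Y n K ν δ) {s t : ℕ} (hst : s ≤ t) {u : Ω → ℝ}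
    (hu : Measurable[sigmaOf Y (Set.Ioo s t)] u) (I : Finset ℕ) (φ : ℕ → ℝ) :
    ∫ ω, u ω * φ (partialSum Y (I \ Finset.Icc s t) ω) ∂μ =
      (∫ ω, u ω ∂μ) * ∫ ω, φ (partialSum Y (I \ Finset.Icc s t) ω) ∂μ := by
  refine integral_mul_of_indep_sigmaOf h.measurable (h.indep_Ioo hst) hu
    (Measurable.of_discrete.comp (measurable_partialSum_sigmaOf fun j hj ↦ ?_))
  have hj' := (Finset.mem_sdiff.1 hj).2
  simp only [Finset.mem_Icc, not_and_or, not_le] at hj'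
  exact hj'

lemma partialSum_range_eq_add_three {k : ℕ} (hk : k < n) (ω : Ω) :
    partialSum Y (Finset.range (n + 4)) ω =
      partialSum Y (Finset.range (n + 4) \ Finset.Icc (k + 1) (k + 3)) ω + Y (k + 1) ω +
        Y (k + 2) ω + Y (k + 3) ω := by
  have hsub : Finset.Icc (k + 1) (k + 3) ⊆ Finset.range (n + 4) := fun j hj ↦
    Finset.mem_range.2 (by have := (Finset.mem_Icc.1 hj).2; omega)
  rw [partialSum, ← Finset.sum_sdiff hsub, partialSum, add_assoc, add_assoc]
  congr 1
  simp [Finset.sum_Icc_succ_top, add_assoc]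

lemma ae_partialSum_range_le (h : IsPaddedOneDependent μ Y n K ν δ) {k : ℕ} (hk : k < n) :
    ∀ᵐ ω ∂μ, partialSum Y (Finset.range (n + 4)) ω ≤
      partialSum Y (Finset.range (n + 4) \ Finset.Icc k (k + 4)) ω + 5 * K := by
  have hsub : Finset.Icc k (k + 4) ⊆ Finset.range (n + 4) := fun j hj ↦
    Finset.mem_range.2 (by have := (Finset.mem_Icc.1 hj).2; omega)
  filter_upwards [h.ae_partialSum_le (Finset.Icc k (k + 4))] with ω hω
  rw [Nat.card_Icc, show k + 4 + 1 - k = 5 by omega] at hω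
  rw [partialSum, ← Finset.sum_sdiff hsub]
  exact Nat.add_le_add_left hω _

section Summand

variable [IsProbabilityMeasure μ] {k x : ℕ}

lemma abs_integral_le_mul_meanEnvelope (h : IsPaddedOneDependent μ Y n K ν δ) (hL : 0 < L)
    {u f : Ω → ℝ} (hu : Measurable[sigmaOf Y (Set.Ioo k (k + 4))] u) (hu' : MemLp u ⊤ μ) {c : ℝ}
    (huc : ∫ ω, u ω ∂μ ≤ c) (hf : ∀ᵐ ω ∂μ, |f ω| ≤ u ω * (steinEnvelope L x
      (partialSum Y (Finset.range (n + 4) \ Finset.Icc k (k + 4)) ω + 5 * K) / L)) :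
    |∫ ω, f ω ∂μ| ≤ c * (meanEnvelope μ Y n K L x k / L) := by
  let φ : ℕ → ℝ := fun v ↦ steinEnvelope L x (v + 5 * K) / L
  have hint : Integrable (fun ω ↦ u ω *
      φ (partialSum Y (Finset.range (n + 4) \ Finset.Icc k (k + 4)) ω)) μ :=
    ((h.memLp_comp_partialSum _ φ).mul' hu' (r := ⊤)).integrable le_top
  refine (norm_integral_le_of_norm_le (f := f) hint hf).trans ?_
  rw [h.integral_mul_comp_partialSum_sdiff (k.le_add_right 4) hu _ φ, integral_div]
  exact mul_le_mul_of_nonneg_right huc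
    (div_nonneg (integral_nonneg fun ω ↦ steinEnvelope_nonneg hL x _) hL.le)

lemma integral_center_le (h : IsPaddedOneDependent μ Y n K ν δ) (k : ℕ) :
    ∫ ω, ((Y (k + 1) ω : ℝ) * Y (k + 2) ω + Y (k + 2) ω * ((Y (k + 2) ω : ℝ) - 1) +
      Y (k + 2) ω * Y (k + 3) ω) ∂μ ≤ 3 * δ := by
  have hi₀ := (h.memLp_mul (k + 1) (k + 2)).integrable le_top
  have hi₁ := (h.memLp_comp (k + 2) fun m ↦ m * ((m : ℝ) - 1)).integrable le_top
  have hi₀₁ : Integrable (fun ω ↦ (Y (k + 1) ω : ℝ) * Y (k + 2) ω +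
    Y (k + 2) ω * ((Y (k + 2) ω : ℝ) - 1)) μ := hi₀.add hi₁
  rw [integral_add hi₀₁ ((h.memLp_mul (k + 2) (k + 3)).integrable le_top), integral_add hi₀ hi₁]
  have h₀ : ∫ ω, (Y (k + 1) ω : ℝ) * Y (k + 2) ω ∂μ ≤ δ := h.mixedMoment_le (k + 1)
  have h₁ : ∫ ω, (Y (k + 2) ω : ℝ) * ((Y (k + 2) ω : ℝ) - 1) ∂μ ≤ δ := h.factMoment2_le (k + 2)
  have h₂ : ∫ ω, (Y (k + 2) ω : ℝ) * Y (k + 3) ω ∂μ ≤ δ := h.mixedMoment_le (k + 2)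
  linarith

lemma abs_integral_center_le (h : IsPaddedOneDependent μ Y n K ν δ) (hL : 0 < L) (hx : L < x)
    (hk : k < n) :
    |∫ ω, (Y (k + 2) ω : ℝ) * (steinSol L x (partialSum Y (Finset.range (n + 4)) ω) -
      steinSol L x
        (partialSum Y (Finset.range (n + 4) \ Finset.Icc (k + 1) (k + 3)) ω + 1)) ∂μ| ≤
      3 * δ * (meanEnvelope μ Y n K L x k / L) := by
  have hmul : ∀ i < 2, Measurable[sigmaOf Y (Set.Ioo k (k + 4))]
      fun ω ↦ (Y (k + 1 + i) ω : ℝ) * Y (k + 2 + i) ω := fun i hi ↦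
    measurable_mul_sigmaOf ⟨by omega, by omega⟩ ⟨by omega, by omega⟩
  refine h.abs_integral_le_mul_meanEnvelope (u := fun ω ↦ (Y (k + 1) ω : ℝ) * Y (k + 2) ω +
    Y (k + 2) ω * ((Y (k + 2) ω : ℝ) - 1) + Y (k + 2) ω * Y (k + 3) ω) hL ?_
    (((h.memLp_mul (k + 1) (k + 2)).add (h.memLp_comp (k + 2) fun m ↦ m * ((m : ℝ) - 1))).add
      (h.memLp_mul (k + 2) (k + 3))) (h.integral_center_le k) ?_
  · exact Measurable.fun_add (m := sigmaOf Y _) (Measurable.fun_add (m := sigmaOf Y _)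
      (hmul 0 (by omega)) (measurable_comp_sigmaOf (Set.mem_Ioo.2 ⟨by omega, by omega⟩)
        fun m ↦ m * ((m : ℝ) - 1))) (hmul 1 (by omega))
  · filter_upwards [h.ae_partialSum_range_le hk] with ω hω
    have hS := partialSum_range_eq_add_three (Y := Y) hk ω
    rcases Nat.eq_zero_or_pos (Y (k + 2) ω) with h0 | h0
    · simp [h0]
    · rw [abs_mul, Nat.abs_cast]
      refine (mul_le_mul_of_nonneg_left (abs_steinSol_sub_le hL hx (by omega)
        (hω.trans (Nat.le_succ _))) (Nat.cast_nonneg _)).trans_eq ?_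
      rw [hS]
      push_cast
      ring

lemma abs_integral_shift_le (h : IsPaddedOneDependent μ Y n K ν δ) (hL : 0 < L) (hx : L < x)
    (hk : k < n) :
    |∫ ω, (steinSol L x
        (partialSum Y (Finset.range (n + 4) \ Finset.Icc (k + 1) (k + 3)) ω + 1) -
      steinSol L x (partialSum Y (Finset.range (n + 4)) ω + 1)) ∂μ| ≤
      3 * ν * (meanEnvelope μ Y n K L x k / L) := by
  have hmem : ∀ j, MemLp (fun ω ↦ (Y j ω : ℝ)) ⊤ μ := fun j ↦ h.memLp_comp j fun m ↦ m
  have hint : ∀ j, Integrable (fun ω ↦ (Y j ω : ℝ)) μ := fun j ↦ (hmem j).integrable le_top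
  have hmeas : ∀ i < 3, Measurable[sigmaOf Y (Set.Ioo k (k + 4))]
      fun ω ↦ (Y (k + 1 + i) ω : ℝ) := fun i hi ↦
    measurable_comp_sigmaOf (Set.mem_Ioo.2 ⟨by omega, by omega⟩) fun m ↦ m
  have hmean : ∀ j, ∫ ω, (Y j ω : ℝ) ∂μ ≤ ν := h.factMoment1_le
  refine h.abs_integral_le_mul_meanEnvelope (u := fun ω ↦ (Y (k + 1) ω : ℝ) + Y (k + 2) ω +
    Y (k + 3) ω) hL ?_ (((hmem _).add (hmem _)).add (hmem _)) ?_ ?_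
  · exact Measurable.fun_add (m := sigmaOf Y _) (Measurable.fun_add (m := sigmaOf Y _)
      (hmeas 0 (by omega)) (hmeas 1 (by omega))) (hmeas 2 (by omega))
  · have hint₂ : Integrable (fun ω ↦ (Y (k + 1) ω : ℝ) + Y (k + 2) ω) μ := (hint _).add (hint _)
    rw [integral_add hint₂ (hint _), integral_add (hint _) (hint _)]
    linarith [hmean (k + 1), hmean (k + 2), hmean (k + 3)]
  · filter_upwards [h.ae_partialSum_range_le hk] with ω hω
    have hS := partialSum_range_eq_add_three (Y := Y) hk ω
    rw [abs_sub_comm]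
    refine (abs_steinSol_sub_le hL hx (by omega) (Nat.succ_le_succ hω)).trans_eq ?_
    rw [hS]
    push_cast
    ring

lemma abs_integral_summand_le (h : IsPaddedOneDependent μ Y n K ν δ) (hL : 0 < L) (hx : L < x)
    (hk : k < n) :
    |∫ ω, (Y (k + 2) ω * steinSol L x (partialSum Y (Finset.range (n + 4)) ω) -
      ν * steinSol L x (partialSum Y (Finset.range (n + 4)) ω + 1)) ∂μ| ≤
      6 * δ * (meanEnvelope μ Y n K L x k / L) := by
  set S := partialSum Y (Finset.range (n + 4))
  set W := partialSum Y (Finset.range (n + 4) \ Finset.Icc (k + 1) (k + 3))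
  let g : ℕ → ℝ := steinSol L x
  have hY : MemLp (fun ω ↦ (Y (k + 2) ω : ℝ)) ⊤ μ := h.memLp_comp (k + 2) fun m ↦ m
  have hS : ∀ i, MemLp (fun ω ↦ g (S ω + i)) ⊤ μ := fun i ↦
    h.memLp_comp_partialSum _ fun v ↦ g (v + i)
  have hW : MemLp (fun ω ↦ g (W ω + 1)) ⊤ μ := h.memLp_comp_partialSum _ fun v ↦ g (v + 1)
  have hYS : Integrable (fun ω ↦ (Y (k + 2) ω : ℝ) * g (S ω)) μ :=
    ((hS 0).mul' hY (r := ⊤)).integrable le_top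
  have hYW : Integrable (fun ω ↦ (Y (k + 2) ω : ℝ) * g (W ω + 1)) μ :=
    (hW.mul' hY (r := ⊤)).integrable le_top
  have hfactor : ∫ ω, (Y (k + 2) ω : ℝ) * g (W ω + 1) ∂μ = ν * ∫ ω, g (W ω + 1) ∂μ := by
    rw [← h.factMoment1_eq k hk]
    exact h.integral_mul_comp_partialSum_sdiff (by omega)
      (measurable_comp_sigmaOf (Set.mem_Ioo.2 ⟨by omega, by omega⟩) fun m ↦ m) _ fun v ↦ g (v + 1)
  have hsplit : ∫ ω, (Y (k + 2) ω * g (S ω) - ν * g (S ω + 1)) ∂μ =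
      ∫ ω, (Y (k + 2) ω : ℝ) * (g (S ω) - g (W ω + 1)) ∂μ +
        ν * ∫ ω, (g (W ω + 1) - g (S ω + 1)) ∂μ := by
    simp_rw [mul_sub]
    rw [integral_sub hYS (((hS 1).integrable le_top).const_mul ν), integral_sub hYS hYW,
      integral_sub (hW.integrable le_top) ((hS 1).integrable le_top), integral_const_mul, hfactor]
    ring
  have hν := h.nonneg_mean
  have hE : 0 ≤ meanEnvelope μ Y n K L x k / L :=
    div_nonneg (integral_nonneg fun ω ↦ steinEnvelope_nonneg hL x _) hL.le
  have hshift := mul_le_mul_of_nonneg_left (h.abs_integral_shift_le hL hx hk) hν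
  have hsq := mul_le_mul_of_nonneg_right h.sq_le hE
  rw [hsplit]
  refine (abs_add_le _ _).trans ?_
  rw [abs_mul ν, abs_of_nonneg hν]
  linarith [h.abs_integral_center_le hL hx hk]

end Summand

lemma partialSum_range_eq_sum (h : IsPaddedOneDependent μ Y n K ν δ) (ω : Ω) :
    partialSum Y (Finset.range (n + 4)) ω = ∑ k ∈ Finset.range n, Y (k + 2) ω := by
  rw [h.partialSum_range_add_four, partialSum, add_comm n, Finset.sum_range_add,
    Finset.sum_eq_zero fun i hi ↦ congrFun (h.eq_zero_of_lt i (Finset.mem_range.1 hi)) ω, zero_add]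
  simp only [add_comm]

lemma measureReal_sub_poissonTail_eq_sum [IsProbabilityMeasure μ]
    (h : IsPaddedOneDependent μ Y n K ν δ) (hL : 0 < n * ν) {x : ℕ} (hx : x ≠ 0) :
    μ.real {ω | x ≤ partialSum Y (Finset.range (n + 4)) ω} - poissonTail (n * ν) x =
      ∑ k ∈ Finset.range n,
        ∫ ω, (Y (k + 2) ω * steinSol (n * ν) x (partialSum Y (Finset.range (n + 4)) ω) -
          ν * steinSol (n * ν) x (partialSum Y (Finset.range (n + 4)) ω + 1)) ∂μ := by
  set S := partialSum Y (Finset.range (n + 4)) with hS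
  let g : ℕ → ℝ := steinSol (n * ν) x
  have hmeas : MeasurableSet {ω | x ≤ S ω} := h.measurable_partialSum _ measurableSet_Ici
  have hint : ∀ k ∈ Finset.range n,
      Integrable (fun ω ↦ Y (k + 2) ω * g (S ω) - ν * g (S ω + 1)) μ := fun k _ ↦
    (((h.memLp_comp_partialSum _ g).mul' (h.memLp_comp (k + 2) fun m ↦ m)
      (r := ⊤)).integrable le_top).sub
        (((h.memLp_comp_partialSum _ fun v ↦ g (v + 1)).integrable le_top).const_mul ν)
  have hpointwise : ∀ ω, ∑ k ∈ Finset.range n, (Y (k + 2) ω * g (S ω) - ν * g (S ω + 1)) =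
      {ω | x ≤ S ω}.indicator 1 ω - poissonTail (n * ν) x := by
    intro ω
    rw [Finset.sum_sub_distrib, ← Finset.sum_mul, Finset.sum_const, Finset.card_range,
      nsmul_eq_mul, ← mul_assoc, ← Nat.cast_sum, ← h.partialSum_range_eq_sum,
      steinSol_equation hL hx]
    simp [Set.indicator_apply, hS]
  rw [← integral_finsetSum _ hint]
  simp_rw [hpointwise]
  rw [integral_sub ((integrable_const _).indicator hmeas) (integrable_const _),
    integral_indicator_one hmeas, integral_const, probReal_univ, one_smul]

section Comparison

variable [IsProbabilityMeasure μ] {x : ℕ} {M γ : ℝ}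

lemma meanEnvelope_le (h : IsPaddedOneDependent μ Y n K ν δ) (hL : 0 < L) (hx : L < x)
    (hx' : x ≤ 1.1 * L) (hM : 1 ≤ M)
    (htail : ∀ j ≤ x, μ.real {ω | j ≤ partialSum Y (Finset.range (n + 4)) ω} ≤
      M * poissonTail L j) (k : ℕ) :
    meanEnvelope μ Y n K L x k ≤
      M * (11 * 1.1 ^ (5 * K)) * (poissonTail L x * (3 + (x - L) ^ 2 / L)) := by
  set V := partialSum Y (Finset.range (n + 4) \ Finset.Icc k (k + 4))
  have hpow : (1 : ℝ) ≤ 1.1 ^ (5 * K) := one_le_pow₀ (by norm_num)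
  have htail' : ∀ j ≤ x, μ.real {ω | j ≤ V ω + 5 * K} ≤
      M * (11 * 1.1 ^ (5 * K)) * poissonTail L j := by
    intro j hj
    have hj' : (j : ℝ) ≤ 1.1 * L := le_trans (by exact_mod_cast hj) hx'
    have hT := poissonTail_nonneg L j
    calc μ.real {ω | j ≤ V ω + 5 * K}
        ≤ μ.real {ω | j - 5 * K ≤ partialSum Y (Finset.range (n + 4)) ω} :=
          measureReal_mono fun ω hω ↦ (Nat.sub_le_iff_le_add.2 hω).trans
            (Finset.sum_le_sum_of_subset Finset.sdiff_subset)
      _ ≤ M * poissonTail L (j - 5 * K) := htail _ ((Nat.sub_le _ _).trans hj)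
      _ ≤ M * ((11 * 1.1 ^ (5 * K) - 10) * poissonTail L j) := by
          gcongr
          exact poissonTail_tsub_le hL hj' _
      _ ≤ M * (11 * 1.1 ^ (5 * K)) * poissonTail L j := by
          rw [mul_assoc]
          gcongr
          linarith
  refine (integral_le_of_measureReal_le hL.le (steinEnvelope_monotone hL hx)
    (steinEnvelope_nonneg hL x 0)
    (fun j hj ↦ (steinEnvelope_of_ge hj).trans (steinEnvelope_of_ge le_rfl).symm)
    ((h.measurable_partialSum _).add_const _) (by nlinarith) htail').trans ?_
  gcongr
  exact sum_steinEnvelope_mul_poissonWeight_le hL hx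

lemma abs_measureReal_sub_poissonTail_le (h : IsPaddedOneDependent μ Y n K ν δ)
    (hγ : 1.1 ^ (5 * K) * δ ≤ γ) (hL : 0 < n * ν) (hx : n * ν < x) (hx' : x ≤ 1.1 * (n * ν))
    (hM : 1 ≤ M)
    (htail : ∀ j ≤ x, μ.real {ω | j ≤ partialSum Y (Finset.range (n + 4)) ω} ≤
      M * poissonTail (n * ν) j) :
    |μ.real {ω | x ≤ partialSum Y (Finset.range (n + 4)) ω} - poissonTail (n * ν) x| ≤
      198 * approxError γ ν n (relDev n x ν) * (M * poissonTail (n * ν) x) := by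
  set L : ℝ := n * ν with hLdef
  have hn : (n : ℝ) ≠ 0 := left_ne_zero_of_mul hL.ne'
  have hν : 0 < ν := h.nonneg_mean.lt_of_ne' (right_ne_zero_of_mul hL.ne')
  have hδ := h.nonneg_secondMoment
  have hγ0 : 0 ≤ γ := (by positivity : (0 : ℝ) ≤ 1.1 ^ (5 * K) * δ).trans hγ
  have hT := poissonTail_nonneg L x
  have hx0 : x ≠ 0 := by
    rintro rfl
    exact hx.not_gt (by exact_mod_cast hL)
  have hterm : ∀ k ∈ Finset.range n,
      |∫ ω, (Y (k + 2) ω * steinSol L x (partialSum Y (Finset.range (n + 4)) ω) -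
        ν * steinSol L x (partialSum Y (Finset.range (n + 4)) ω + 1)) ∂μ| ≤
      6 * δ * (M * (11 * 1.1 ^ (5 * K)) * (poissonTail L x * (3 + (x - L) ^ 2 / L)) / L) := by
    intro k hk
    refine (h.abs_integral_summand_le hL hx (Finset.mem_range.1 hk)).trans ?_
    gcongr
    exact h.meanEnvelope_le hL hx hx' hM htail k
  rw [h.measureReal_sub_poissonTail_eq_sum hL hx0]
  calc _ ≤ ∑ k ∈ Finset.range n, 6 * δ * (M * (11 * 1.1 ^ (5 * K)) *
        (poissonTail L x * (3 + (x - L) ^ 2 / L)) / L) :=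
        (Finset.abs_sum_le_sum_abs _ _).trans (Finset.sum_le_sum hterm)
    _ = 66 * (1.1 ^ (5 * K) * δ * (3 * ν⁻¹ + n * relDev n x ν ^ 2)) * (M * poissonTail L x) := by
        rw [Finset.sum_const, Finset.card_range, nsmul_eq_mul, relDev, hLdef]
        field_simp
        ring
    _ ≤ 66 * (γ * (3 * (ν⁻¹ + n * relDev n x ν ^ 2))) * (M * poissonTail L x) := by
        have hdev : 0 ≤ n * relDev n x ν ^ 2 := by positivity
        gcongr
        linarith
    _ = _ := by
        rw [approxError]
        ring

end Comparison

end IsPaddedOneDependent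

namespace IsPaddedOneDependent

variable {Ω : Type*} {mΩ : MeasurableSpace Ω} {μ : Measure Ω}
  {Y : ℕ → Ω → ℕ} {n K x : ℕ} {ν δ γ y : ℝ}

lemma sq_mean_le (h : IsPaddedOneDependent μ Y n K ν δ) (hγ : 1.1 ^ (5 * K) * δ ≤ γ) :
    ν ^ 2 ≤ γ :=
  h.sq_le.trans ((le_mul_of_one_le_left h.nonneg_secondMoment (one_le_pow₀ (by norm_num))).trans hγ)

variable [IsProbabilityMeasure μ]

lemma measureReal_le_exp_eight_mul_poissonTail (h : IsPaddedOneDependent μ Y n K ν δ)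
    (hγ : 1.1 ^ (5 * K) * δ ≤ γ) (hN : 10 / 11 ≤ n * ν) (hx : x ≤ 1.1 * (n * ν))
    (hsmall : 400 * approxError γ ν n (relDev n x ν) ≤ 1) :
    ∀ j ≤ x, μ.real {ω | j ≤ partialSum Y (Finset.range (n + 4)) ω} ≤
      Real.exp 8 * poissonTail (n * ν) j := by
  set P : ℕ → ℝ := fun j ↦ μ.real {ω | j ≤ partialSum Y (Finset.range (n + 4)) ω}
  set T : ℕ → ℝ := poissonTail (n * ν)
  have hN0 : 0 < n * ν := by linarith
  have hT : ∀ j, 0 < T j := poissonTail_pos hN0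
  obtain ⟨m, hm, hmax⟩ := Finset.exists_max_image (Finset.range (x + 1)) (fun j ↦ P j / T j)
    ⟨0, by simp⟩
  set M := P m / T m with hMdef
  have htail : ∀ j ≤ x, P j ≤ M * T j := fun j hj ↦
    (div_le_iff₀ (hT j)).1 (hmax j (Finset.mem_range.2 (Nat.lt_succ_of_le hj)))
  have hM : 1 ≤ M := by simpa [P, T, poissonTail_zero] using hmax 0 (by simp)
  have hmx : m ≤ x := Nat.lt_succ_iff.1 (Finset.mem_range.1 hm)
  suffices hM8 : M ≤ Real.exp 8 from fun j hj ↦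
    (htail j hj).trans (mul_le_mul_of_nonneg_right hM8 (hT j).le)
  rcases le_or_gt (m : ℝ) (n * ν) with hmN | hmN
  · rw [hMdef, div_le_iff₀ (hT m)]
    calc P m ≤ Real.exp 8 * Real.exp (-8) := by
          rw [← Real.exp_add, add_neg_cancel, Real.exp_zero]
          exact measureReal_le_one
      _ ≤ Real.exp 8 * T m := by
          gcongr
          exact exp_neg_eight_le_poissonTail hN hmN
  · have hmx' : (m : ℝ) ≤ x := by exact_mod_cast hmx
    have hγ0 : 0 ≤ γ := (sq_nonneg ν).trans (h.sq_mean_le hγ)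
    have herr := approxError_relDev_mono hγ0 hN0 hmN.le hmx
    have hstein := h.abs_measureReal_sub_poissonTail_le hγ hN0 hmN (hmx'.trans hx) hM
      fun j hj ↦ htail j (hj.trans hmx)
    have hPm : P m = M * T m := (div_mul_cancel₀ _ (hT m).ne').symm
    have hboot : M * T m - T m ≤ 1 / 2 * (M * T m) := by
      rw [← hPm]
      refine (le_abs_self _).trans (hstein.trans ?_)
      rw [hPm]
      have := (hT m).le
      gcongr
      linarith
    have hM2 : M ≤ 2 := le_of_mul_le_mul_right (by linarith) (hT m)
    linarith [Real.add_one_le_exp (8 : ℝ)]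

lemma abs_measureReal_sub_poissonTail_le_of_small (h : IsPaddedOneDependent μ Y n K ν δ)
    (hγ : 1.1 ^ (5 * K) * δ ≤ γ) (hN : 10 / 11 ≤ n * ν) (hy0 : 0 < y) (hy : y ≤ 1 / 10)
    (hx : (x : ℝ) = n * ν * (1 + y)) (hsmall : 400 * approxError γ ν n y ≤ 1) :
    |μ.real {ω | x ≤ partialSum Y (Finset.range (n + 4)) ω} - poissonTail (n * ν) x| ≤
      198 * approxError γ ν n y * (Real.exp 8 * poissonTail (n * ν) x) := by
  have hN0 : 0 < n * ν := by linarith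
  have hx' : (x : ℝ) ≤ 1.1 * (n * ν) := by rw [hx]; nlinarith
  rw [← relDev_eq hN0.ne' hx] at hsmall ⊢
  exact h.abs_measureReal_sub_poissonTail_le hγ hN0 (by rw [hx]; nlinarith) hx'
    (Real.one_le_exp (by norm_num)) (h.measureReal_le_exp_eight_mul_poissonTail hγ hN hx' hsmall)

lemma measureReal_mul_one_add_pow_le_exp (h : IsPaddedOneDependent μ Y n K ν δ)
    (hγ : 1.1 ^ (5 * K) * δ ≤ γ) (hy0 : 0 ≤ y) (hy : y ≤ 1 / 10) (x : ℕ) :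
    μ.real {ω | x ≤ partialSum Y (Finset.range (n + 4)) ω} * (1 + y) ^ x ≤
      Real.exp (n * ν * y) * (1 + 3 / 2 * γ * y ^ 2) ^ n := by
  have hν := h.nonneg_mean
  have hδ := h.nonneg_secondMoment
  have hγ0 : 0 ≤ γ := (sq_nonneg ν).trans (h.sq_mean_le hγ)
  have hpow : δ * (1 + y) ^ (3 * K) ≤ γ := by
    refine le_trans ?_ hγ
    rw [mul_comm]
    gcongr
    calc (1 + y) ^ (3 * K) ≤ 1.1 ^ (3 * K) := by gcongr; linarith
      _ ≤ 1.1 ^ (5 * K) := pow_le_pow_right₀ (by norm_num) (by omega)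
  refine (h.measureReal_mul_one_add_pow_le hy0 x).trans ?_
  rw [mul_assoc (n : ℝ), Real.exp_nat_mul, ← mul_pow]
  gcongr
  calc 1 + ν * y + 3 / 2 * δ * y ^ 2 * (1 + y) ^ (3 * K)
      = (ν * y + 1) + 3 / 2 * (δ * (1 + y) ^ (3 * K)) * y ^ 2 := by ring
    _ ≤ (ν * y + 1) + 3 / 2 * γ * y ^ 2 := by gcongr
    _ ≤ (ν * y + 1) * (1 + 3 / 2 * γ * y ^ 2) := by
        have : 0 ≤ ν * y * (3 / 2 * γ * y ^ 2) := by positivity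
        linarith
    _ ≤ Real.exp (ν * y) * (1 + 3 / 2 * γ * y ^ 2) := by
        gcongr
        exact Real.add_one_le_exp _

lemma abs_ratio_sub_one_le_of_small (h : IsPaddedOneDependent μ Y n K ν δ)
    (hγ : 1.1 ^ (5 * K) * δ ≤ γ) (hN : 10 / 11 ≤ n * ν) (hν0 : 0 < ν) (hν : ν ≤ 1 / 100)
    (hy0 : 0 < y) (hy : y ≤ 1 / 10) (hx : (x : ℝ) = n * ν * (1 + y))
    (hsmall : 400 * approxError γ ν n y ≤ 1) :
    |μ.real {ω | x ≤ partialSum Y (Finset.range (n + 4)) ω} /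
      poissonTail (n * lambdaStar ν y) x - 1| ≤ 225 * Real.exp 8 * approxError γ ν n y := by
  have hN0 : 0 < n * ν := by linarith
  have hε := approxError_nonneg ((sq_nonneg ν).trans (h.sq_mean_le hγ)) hν0.le n y
  have hu0 := paramShift_nonneg hν0.le (by linarith) hy0.le
  have hu := paramShift_le hν0.le hν hy0.le
  have hL : 0 < n * lambdaStar ν y := by
    rw [mul_lambdaStar]
    exact mul_pos hN0 (by nlinarith)
  have hstein := h.abs_measureReal_sub_poissonTail_le_of_small hγ hN hy0 hy hx hsmall
  have hshift := poissonTail_sub_poissonTail_lambdaStar_le (h.sq_mean_le hγ) hN0 hν0 hν hy0.le hy hx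
  have hmono : poissonTail (n * lambdaStar ν y) x ≤ poissonTail (n * ν) x := by
    refine poissonTail_monotoneOn x hL hN0 ?_
    rw [mul_lambdaStar]
    exact mul_le_of_le_one_right hN0.le (by linarith)
  have hpos := poissonTail_pos hL x
  set ε := approxError γ ν n y
  set P := μ.real {ω | x ≤ partialSum Y (Finset.range (n + 4)) ω}
  set T := poissonTail (n * ν) x
  set T' := poissonTail (n * lambdaStar ν y) x
  have hTT' : T ≤ 1.05 * T' := by
    have : ε * T ≤ 1 / 400 * T := mul_le_mul_of_nonneg_right (by linarith) (by linarith)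
    linarith
  have he : 1 ≤ Real.exp 8 := Real.one_le_exp (by norm_num)
  rw [div_sub_one hpos.ne', abs_div, abs_of_pos hpos, div_le_iff₀ hpos]
  calc |P - T'| ≤ |P - T| + |T - T'| := abs_sub_le P T T'
    _ ≤ 198 * ε * (Real.exp 8 * T) + 16 * ε * (Real.exp 8 * T) := by
        rw [abs_of_nonneg (sub_nonneg.2 hmono)]
        refine add_le_add hstein (hshift.trans ?_)
        gcongr
        exact le_mul_of_one_le_left (by linarith) he
    _ = 214 * (Real.exp 8 * ε) * T := by ring
    _ ≤ 214 * (Real.exp 8 * ε) * (1.05 * T') := by gcongr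
    _ ≤ 225 * Real.exp 8 * ε * T' := by
        have : 0 ≤ Real.exp 8 * ε * T' := by positivity
        linarith

lemma ratio_le_mainTerm_mul (h : IsPaddedOneDependent μ Y n K ν δ)
    (hγ : 1.1 ^ (5 * K) * δ ≤ γ) (hN : 0 < n * ν) (hν0 : 0 < ν) (hν : ν ≤ 1 / 100)
    (hy0 : 0 ≤ y) (hy : y ≤ 1 / 10) (hx : (x : ℝ) = n * ν * (1 + y)) :
    μ.real {ω | x ≤ partialSum Y (Finset.range (n + 4)) ω} /
      poissonTail (n * lambdaStar ν y) x ≤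
      mainTerm γ ν n y * (2 * Real.exp 4 * (1 + y * √(n * ν))) := by
  set u := paramShift ν y
  have hu0 : 0 ≤ u := paramShift_nonneg hν0.le (by linarith) hy0
  have hu : u ≤ 1.02 * (ν * y) := paramShift_le hν0.le hν hy0
  have huy : u ≤ y / 50 := by nlinarith
  have hγ0 : 0 ≤ γ := (sq_nonneg ν).trans (h.sq_mean_le hγ)
  have hpos : 0 < poissonTail (n * lambdaStar ν y) x :=
    poissonTail_pos (by rw [mul_lambdaStar]; exact mul_pos hN (by linarith)) x
  have hexponent : Real.exp (n * ν * (u * (y + u) / (1 - u))) ≤ Real.exp (2 * (ν * y) ^ 2) ^ n := by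
    rw [← Real.exp_nat_mul, mul_assoc, Real.exp_le_exp]
    refine mul_le_mul_of_nonneg_left ?_ n.cast_nonneg
    calc ν * (u * (y + u) / (1 - u)) ≤ ν * (1.02 * (ν * y) * (y + y / 50) / 0.9) := by
          gcongr
          linarith
      _ = 1.156 * (ν * y) ^ 2 := by ring
      _ ≤ 2 * (ν * y) ^ 2 := by
          gcongr
          norm_num
  rw [div_le_iff₀ hpos]
  refine le_of_mul_le_mul_right ?_ (by positivity : 0 < (1 + y) ^ x)
  calc μ.real {ω | x ≤ partialSum Y (Finset.range (n + 4)) ω} * (1 + y) ^ x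
      ≤ Real.exp (n * ν * y) * (1 + 3 / 2 * γ * y ^ 2) ^ n :=
        h.measureReal_mul_one_add_pow_le_exp hγ hy0 hy x
    _ ≤ 2 * Real.exp 4 * (1 + y * √(n * ν)) * Real.exp (2 * (ν * y) ^ 2) ^ n *
          (poissonTail (n * lambdaStar ν y) x * (1 + y) ^ x) * (1 + 3 / 2 * γ * y ^ 2) ^ n := by
        rw [mul_lambdaStar]
        gcongr
        refine (exp_le_poissonTail_shift hN hy hu0 (by linarith) hx).trans ?_
        rw [mul_lambdaStar] at hpos
        gcongr
    _ = Real.exp (2 * (ν * y) ^ 2) ^ n * (1 + 3 / 2 * γ * y ^ 2) ^ n *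
          (2 * Real.exp 4 * (1 + y * √(n * ν))) *
          poissonTail (n * lambdaStar ν y) x * (1 + y) ^ x := by ring
    _ ≤ _ := by
        gcongr
        exact exp_pow_mul_le_mainTerm (h.sq_mean_le hγ) hν0.le hν hy0 hy

lemma abs_ratio_sub_mainTerm_le_of_small (h : IsPaddedOneDependent μ Y n K ν δ)
    (hγ : 1.1 ^ (5 * K) * δ ≤ γ) (hN : 10 / 11 ≤ n * ν) (hν0 : 0 < ν) (hν : ν ≤ 1 / 100)
    (hy0 : 0 < y) (hy : y ≤ 1 / 10) (hx : (x : ℝ) = n * ν * (1 + y))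
    (hsmall : 400 * approxError γ ν n y ≤ 1) :
    |μ.real {ω | x ≤ partialSum Y (Finset.range (n + 4)) ω} /
      poissonTail (n * lambdaStar ν y) x - mainTerm γ ν n y| ≤
      mainTerm γ ν n y * (1000 * Real.exp 8 * (√(n * ν) * approxError γ ν n y)) := by
  have hγ0 : 0 ≤ γ := (sq_nonneg ν).trans (h.sq_mean_le hγ)
  have hε := approxError_nonneg hγ0 hν0.le n y
  have hA := one_le_mainTerm hγ0 n (paramShift_nonneg hν0.le (by linarith) hy0.le)
  have hA' := mainTerm_le_of_small (h.sq_mean_le hγ) hν0.le hν hy0.le hy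
    (by linarith : 8 * approxError γ ν n y ≤ 1)
  have hone := h.abs_ratio_sub_one_le_of_small hγ hN hν0 hν hy0 hy hx hsmall
  set ε := approxError γ ν n y
  set A := mainTerm γ ν n y
  have hsqrt : 0.9 ≤ √(n * ν) := Real.le_sqrt_of_sq_le (by linarith)
  have hexp : ε ≤ Real.exp 8 * ε := le_mul_of_one_le_left hε (Real.one_le_exp (by norm_num))
  refine (abs_sub_le _ 1 _).trans ?_
  rw [abs_sub_comm 1 A, abs_of_nonneg (sub_nonneg.2 hA)]
  calc _ ≤ 225 * Real.exp 8 * ε + 16 * (Real.exp 8 * ε) := by linarith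
    _ ≤ 1000 * Real.exp 8 * (0.9 * ε) := by linarith
    _ ≤ 1000 * Real.exp 8 * (√(n * ν) * ε) := by gcongr
    _ ≤ _ := le_mul_of_one_le_left (by positivity) hA

lemma abs_ratio_sub_mainTerm_le_of_large (h : IsPaddedOneDependent μ Y n K ν δ)
    (hγ : 1.1 ^ (5 * K) * δ ≤ γ) (hN : 10 / 11 ≤ n * ν) (hν0 : 0 < ν) (hν : ν ≤ 1 / 100)
    (hy0 : 0 ≤ y) (hy : y ≤ 1 / 10) (hx : (x : ℝ) = n * ν * (1 + y))
    (hlarge : 1 ≤ 400 * approxError γ ν n y) :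
    |μ.real {ω | x ≤ partialSum Y (Finset.range (n + 4)) ω} /
      poissonTail (n * lambdaStar ν y) x - mainTerm γ ν n y| ≤
      mainTerm γ ν n y * (1000 * Real.exp 8 * (√(n * ν) * approxError γ ν n y)) := by
  have hratio := h.ratio_le_mainTerm_mul hγ (by linarith) hν0 hν hy0 hy hx
  have hA : 0 ≤ mainTerm γ ν n y := zero_le_one.trans (one_le_mainTerm
    ((sq_nonneg ν).trans (h.sq_mean_le hγ)) n (paramShift_nonneg hν0.le (by linarith) hy0))
  have hsqrt : 0.9 ≤ √(n * ν) := Real.le_sqrt_of_sq_le (by linarith)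
  have hfactor : 2 * Real.exp 4 * (1 + y * √(n * ν)) ≤
      1000 * Real.exp 8 * (√(n * ν) * approxError γ ν n y) := by
    calc 2 * Real.exp 4 * (1 + y * √(n * ν))
        ≤ 2 * Real.exp 8 * (10 / 9 * √(n * ν) + 1 / 10 * √(n * ν)) := by
          gcongr
          · norm_num
          · linarith
      _ ≤ 1000 * Real.exp 8 * (√(n * ν) * (1 / 400)) := by
          have : 0 ≤ Real.exp 8 * √(n * ν) := by positivity
          linarith
      _ ≤ _ := by
          gcongr
          linarith
  have hone : 1 ≤ 1000 * Real.exp 8 * (√(n * ν) * approxError γ ν n y) := by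
    calc (1 : ℝ) ≤ 1000 * 1 * (0.9 * (1 / 400)) := by norm_num
      _ ≤ _ := by
          gcongr
          · exact Real.one_le_exp (by norm_num)
          · linarith
  exact abs_sub_le_of_nonneg_of_le (div_nonneg measureReal_nonneg (poissonTail_nonneg _ _))
    (hratio.trans (mul_le_mul_of_nonneg_left hfactor hA)) hA (le_mul_of_one_le_right hA hone)

lemma abs_ratio_sub_mainTerm_le (h : IsPaddedOneDependent μ Y n K ν δ)
    (hγ : 1.1 ^ (5 * K) * δ ≤ γ) (hN : 10 / 11 ≤ n * ν) (hν0 : 0 < ν) (hν : ν ≤ 1 / 100)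
    (hy0 : 0 < y) (hy : y ≤ 1 / 10) (hx : (x : ℝ) = n * ν * (1 + y)) :
    |μ.real {ω | x ≤ partialSum Y (Finset.range (n + 4)) ω} /
      poissonTail (n * lambdaStar ν y) x - mainTerm γ ν n y| ≤
      mainTerm γ ν n y * (1000 * Real.exp 8 * (√(n * ν) * approxError γ ν n y)) := by
  rcases le_total (400 * approxError γ ν n y) 1 with hsmall | hlarge
  · exact h.abs_ratio_sub_mainTerm_le_of_small hγ hN hν0 hν hy0 hy hx hsmall
  · exact h.abs_ratio_sub_mainTerm_le_of_large hγ hN hν0 hν hy0.le hy hx hlarge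

end IsPaddedOneDependent

/-- The sequence with `X 1, …, X n` at the indices `2, …, n + 1` and zeros elsewhere. -/
def padded {Ω : Type*} (X : ℕ → Ω → ℕ) (n j : ℕ) : Ω → ℕ :=
  if 2 ≤ j ∧ j < n + 2 then X (j - 1) else 0

section Padded

variable {Ω : Type*} {X : ℕ → Ω → ℕ} {n : ℕ}

lemma padded_eq_zero {j : ℕ} (hj : ¬(2 ≤ j ∧ j < n + 2)) : padded X n j = 0 :=
  if_neg hj

lemma padded_add_two {k : ℕ} (hk : k < n) : padded X n (k + 2) = X (k + 1) :=
  if_pos ⟨Nat.le_add_left 2 k, by omega⟩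

lemma padded_induction {p : (Ω → ℕ) → Prop} (hX : ∀ k ∈ Finset.Icc 1 n, p (X k)) (h0 : p 0)
    (j : ℕ) : p (padded X n j) := by
  unfold padded
  split_ifs with hj
  · exact hX _ (Finset.mem_Icc.2 (by omega))
  · exact h0

lemma sigmaOf_padded_le {I J : Set ℕ} (h : ∀ j ∈ I, 2 ≤ j → j < n + 2 → j - 1 ∈ J) :
    sigmaOf (padded X n) I ≤ sigmaOf X J := by
  refine iSup₂_le fun j hj ↦ ?_
  unfold padded
  split_ifs with hj'
  · exact le_iSup₂ (f := fun i (_ : i ∈ J) ↦ MeasurableSpace.comap (X i) inferInstance) (j - 1)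
      (h j hj hj'.1 hj'.2)
  · exact MeasurableSpace.comap_const (0 : ℕ) |>.trans_le bot_le

lemma partialSum_padded (X : ℕ → Ω → ℕ) (n : ℕ) (ω : Ω) :
    partialSum (padded X n) (Finset.range (n + 4)) ω = ∑ k ∈ Finset.Icc 1 n, X k ω := by
  rw [partialSum, Finset.sum_range_succ, Finset.sum_range_succ, Finset.sum_range_succ',
    Finset.sum_range_succ', padded_eq_zero (by omega), padded_eq_zero (by omega),
    padded_eq_zero (by omega), padded_eq_zero (by omega)]
  simp only [Pi.zero_apply, add_zero]
  rw [Finset.sum_congr rfl fun k hk ↦ congrFun (padded_add_two (Finset.mem_range.1 hk)) ω,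
    Finset.range_eq_Ico, Finset.sum_Ico_add' (fun k ↦ X k ω) 0 n 1]
  rfl

variable [MeasurableSpace Ω] {μ : Measure Ω}

lemma IsMDependent.indep_padded [IsProbabilityMeasure μ] (h : IsMDependent 1 n X μ) (s : ℕ) :
    Indep (sigmaOf (padded X n) (Set.Iio s)) (sigmaOf (padded X n) (Set.Ioi s)) μ := by
  have hbot {I : Set ℕ} (hI : ∀ j ∈ I, ¬(2 ≤ j ∧ j < n + 2)) : sigmaOf (padded X n) I = ⊥ :=
    le_bot_iff.1 ((sigmaOf_padded_le (J := ∅) fun j hj h2 hn ↦ (hI j hj ⟨h2, hn⟩).elim).trans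
      (by simp))
  rcases le_or_gt s 2 with hs2 | hs2
  · rw [hbot (I := Set.Iio s) fun j hj ↦ by have := Set.mem_Iio.1 hj; omega]
    exact indep_bot_left _
  rcases le_or_gt (n + 1) s with hsn | hsn
  · rw [hbot (I := Set.Ioi s) fun j hj ↦ by have := Set.mem_Ioi.1 hj; omega]
    exact indep_bot_right _
  refine indep_of_indep_of_le_right (indep_of_indep_of_le_left
    (h (s - 2) s (by omega) (by omega) (by omega)) ?_) ?_
  · exact sigmaOf_padded_le fun j hj h2 _ ↦ by
      have := Set.mem_Iio.1 hj
      exact ⟨by omega, by omega⟩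
  · exact sigmaOf_padded_le fun j hj _ hn ↦ by
      have := Set.mem_Ioi.1 hj
      exact ⟨by omega, by omega⟩

lemma mixedMoment_padded_le {δ : ℝ} (hδ : 0 ≤ δ)
    (hmix : ∀ k ∈ Finset.Ico 1 n, mixedMoment (X k) (X (k + 1)) μ ≤ δ) (j : ℕ) :
    mixedMoment (padded X n j) (padded X n (j + 1)) μ ≤ δ := by
  by_cases hj : 2 ≤ j ∧ j < n + 1
  · obtain ⟨k, rfl⟩ := Nat.exists_eq_add_of_le' hj.1
    rw [padded_add_two (by omega), add_right_comm, padded_add_two (by omega)]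
    exact hmix _ (Finset.mem_Ico.2 (by omega))
  · have hzero : padded X n j = 0 ∨ padded X n (j + 1) = 0 := by
      by_cases h2 : j < n + 1
      · exact Or.inl (padded_eq_zero (by omega))
      · exact Or.inr (padded_eq_zero (by omega))
    rcases hzero with h | h <;> simpa [mixedMoment, h] using hδ

lemma isPaddedOneDependent_padded [IsProbabilityMeasure μ] {K : ℕ} {ν δ : ℝ}
    (hX : ∀ k ∈ Finset.Icc 1 n, Measurable (X k)) (hdep : IsMDependent 1 n X μ)
    (hK : ∀ k ∈ Finset.Icc 1 n, ∀ᵐ ω ∂μ, X k ω ≤ K) (hν : 0 ≤ ν)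
    (hmean : ∀ k ∈ Finset.Icc 1 n, factMoment1 (X k) μ = ν)
    (hfact : ∀ k ∈ Finset.Icc 1 n, factMoment2 (X k) μ ≤ δ)
    (hmix : ∀ k ∈ Finset.Ico 1 n, mixedMoment (X k) (X (k + 1)) μ ≤ δ) (hsq : ν ^ 2 ≤ δ) :
    IsPaddedOneDependent μ (padded X n) n K ν δ where
  measurable := padded_induction hX measurable_zero
  ae_le := padded_induction (p := fun Z ↦ ∀ᵐ ω ∂μ, Z ω ≤ K) hK (by simp)
  indep := hdep.indep_padded
  eq_zero_of_lt j hj := padded_eq_zero (by omega)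
  eq_zero_of_ge j hj := padded_eq_zero (by omega)
  factMoment1_eq k hk := by
    rw [padded_add_two hk]
    exact hmean _ (Finset.mem_Icc.2 (by omega))
  factMoment1_le := padded_induction (p := fun Z ↦ factMoment1 Z μ ≤ ν) (fun k hk ↦ (hmean k hk).le)
    (by simpa [factMoment1] using hν)
  factMoment2_le := padded_induction (p := fun Z ↦ factMoment2 Z μ ≤ δ) hfact
    (by simpa [factMoment2] using (sq_nonneg ν).trans hsq)
  mixedMoment_le := mixedMoment_padded_le ((sq_nonneg ν).trans hsq) hmix
  sq_le := hsq

end Padded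

section Moments

variable {Ω : Type*} [MeasurableSpace Ω] {μ : Measure Ω} {Y Z : Ω → ℕ}

lemma factMoment1_congr (h : IdentDistrib Y Z μ μ) : factMoment1 Y μ = factMoment1 Z μ :=
  (h.comp (measurable_of_countable fun m : ℕ ↦ (m : ℝ))).integral_eq

lemma factMoment2_congr (h : IdentDistrib Y Z μ μ) : factMoment2 Y μ = factMoment2 Z μ :=
  (h.comp (measurable_of_countable fun m : ℕ ↦ (m : ℝ) * (m - 1))).integral_eq

end Moments

lemma exists_eq_mul_one_add_of_abs_sub_le {R A E : ℝ} (hA : 0 < A) (hE : 0 < E)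
    (h : |R - A| ≤ A * E) : ∃ θ : ℝ, |θ| ≤ 1 ∧ R = A * (1 + θ * E) := by
  refine ⟨(R - A) / (A * E), ?_, by field_simp; ring⟩
  have hAE := mul_pos hA hE
  rwa [abs_div, abs_of_pos hAE, div_le_one hAE]

lemma pow_floor_le_exp {C : ℝ} (hC : 0 ≤ C) : (1.1 : ℝ) ^ (5 * ⌊C⌋₊) ≤ Real.exp (1.5 * C) := by
  calc (1.1 : ℝ) ^ (5 * ⌊C⌋₊) ≤ Real.exp 0.3 ^ (5 * ⌊C⌋₊) := by
        gcongr
        linarith [Real.add_one_le_exp (0.3 : ℝ)]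
    _ = Real.exp (1.5 * ⌊C⌋₊) := by
        rw [← Real.exp_nat_mul]
        congr 1
        push_cast
        ring
    _ ≤ Real.exp (1.5 * C) := by
        gcongr
        exact Nat.floor_le hC

theorem theorem2_general {Ω : Type*} [MeasurableSpace Ω] {μ : Measure Ω} [IsProbabilityMeasure μ]
    {n x : ℕ} {X : ℕ → Ω → ℕ} {C₀ ν₁ ν₂ κ y : ℝ} (hn : 1 ≤ n)
    (hX : ∀ k ∈ Finset.Icc 1 n, Measurable (X k)) (hdep : IsMDependent 1 n X μ)
    (hν₁ : ∀ k ∈ Finset.Icc 1 n, factMoment1 (X k) μ = ν₁)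
    (hν₂ : ∀ k ∈ Finset.Icc 1 n, factMoment2 (X k) μ ≤ ν₂)
    (hκ : ∀ k ∈ Finset.Ico 1 n, mixedMoment (X k) (X (k + 1)) μ ≤ κ)
    (hC₀ : ∀ k ∈ Finset.Icc 1 n, ∀ᵐ ω ∂μ, (X k ω : ℝ) ≤ C₀)
    (hν_pos : 0 < ν₁) (hν_small : ν₁ ≤ 1 / 100) (hy : y = relDev n x ν₁) (hy' : y ≤ 1 / 10)
    (hx : n * ν₁ < x) :
    ∃ θ : ℝ, |θ| ≤ 1 ∧
      μ.real {ω | x ≤ ∑ k ∈ Finset.Icc 1 n, X k ω} / poissonTail (n * lambdaStar ν₁ y) x =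
        Real.exp (LambdaStar n ν₁ y) * (1 + 6 * gammaCoeff C₀ ν₁ ν₂ κ * y ^ 2) ^ n *
          (1 + 1000 * Real.exp 8 * θ * gammaCoeff C₀ ν₁ ν₂ κ * √(n * ν₁) *
            (ν₁⁻¹ + n * y ^ 2)) := by
  set δ := max (max (ν₁ ^ 2) ν₂) κ
  set γ := gammaCoeff C₀ ν₁ ν₂ κ
  have hsq : ν₁ ^ 2 ≤ δ := (le_max_left _ _).trans (le_max_left _ _)
  have hC : 0 ≤ C₀ := by
    obtain ⟨ω, hω⟩ := (hC₀ 1 (Finset.mem_Icc.2 ⟨le_rfl, hn⟩)).exists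
    exact (Nat.cast_nonneg _).trans hω
  have hpad : IsPaddedOneDependent μ (padded X n) n ⌊C₀⌋₊ ν₁ δ :=
    isPaddedOneDependent_padded hX hdep (fun k hk ↦ (hC₀ k hk).mono fun ω ↦ Nat.le_floor)
      hν_pos.le hν₁ (fun k hk ↦ (hν₂ k hk).trans ((le_max_right _ _).trans (le_max_left _ _)))
      (fun k hk ↦ (hκ k hk).trans (le_max_right _ _)) hsq
  have hγ : 1.1 ^ (5 * ⌊C₀⌋₊) * δ ≤ γ :=
    mul_le_mul_of_nonneg_right (pow_floor_le_exp hC) ((sq_nonneg ν₁).trans hsq)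
  have hN : 0 < n * ν₁ := by positivity
  have hx' : (x : ℝ) = n * ν₁ * (1 + y) := hy ▸ natCast_eq_of_relDev hN.ne' x
  have hx1 : (1 : ℝ) ≤ x := by
    exact_mod_cast Nat.one_le_iff_ne_zero.2 fun h ↦ by simp [h] at hx; linarith
  have hN' : 10 / 11 ≤ n * ν₁ := by nlinarith
  have hy0 : 0 < y := by nlinarith
  have hγ0 : 0 < γ := by nlinarith [hpad.sq_mean_le hγ]
  have hratio := hpad.abs_ratio_sub_mainTerm_le hγ hN' hν_pos hν_small hy0 hy' hx'
  simp only [partialSum_padded] at hratio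
  obtain ⟨θ, hθ, h⟩ := exists_eq_mul_one_add_of_abs_sub_le
    (by unfold mainTerm; positivity) (by unfold approxError; positivity) hratio
  exact ⟨θ, hθ, by rw [h, mainTerm, approxError]; ring⟩

theorem theorem2 :
    ∃ C₃ > (0 : ℝ), ∃ C₄ > (0 : ℝ),
      ∀ (Ω : Type*) [MeasurableSpace Ω] (μ : Measure Ω) [IsProbabilityMeasure μ]
        (n x : ℕ) (X : ℕ → Ω → ℕ) (C₀ ν₁ ν₂ κ y γ : ℝ),
        1 ≤ n →
        (∀ k ∈ Finset.Icc 1 n, Measurable (X k)) →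
        (∀ k ∈ Finset.Icc 1 n, IdentDistrib (X k) (X 1) μ μ) →
        IsMDependent 1 n X μ →
        (∀ k ∈ Finset.Ico 1 n, mixedMoment (X k) (X (k + 1)) μ = mixedMoment (X 1) (X 2) μ) →
        ν₁ = factMoment1 (X 1) μ →
        ν₂ = factMoment2 (X 1) μ →
        κ = mixedMoment (X 1) (X 2) μ →
        y = relDev n x ν₁ →
        γ = gammaCoeff C₀ ν₁ ν₂ κ →
        0 < ν₁ →
        1 ≤ C₀ →
        (∀ᵐ ω ∂μ, (X 1 ω : ℝ) ≤ C₀) →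
        Real.exp (5 * C₀) * ν₁ ≤ 0.002 →
        |y| ≤ 1 / 10 →
        ν₂ ≤ ν₁ * Real.exp (-(1.5 * C₀)) / 20 →
        κ ≤ ν₁ * Real.exp (-(1.5 * C₀)) / 20 →
        (n : ℝ) * ν₁ < x →
        ∃ θ : ℝ, |θ| ≤ 1 ∧
          μ.real {ω | x ≤ ∑ k ∈ Finset.Icc 1 n, X k ω} / poissonTail (n * lambdaStar ν₁ y) x =
            Real.exp (LambdaStar n ν₁ y) * (1 + C₃ * γ * y ^ 2) ^ n *
              (1 + C₄ * θ * γ * Real.sqrt (n * ν₁) * (ν₁⁻¹ + n * y ^ 2)) := by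
  refine ⟨6, by norm_num, 1000 * Real.exp 8, by positivity, ?_⟩
  rintro Ω _ μ _ n x X C₀ ν₁ ν₂ κ y _ hn hX hid hdep hmix hν₁ hν₂ hκ hy rfl hν_pos hC₀ hbound
    hν_small hy' - - hx
  have hν : ν₁ ≤ 0.002 := by nlinarith [Real.one_le_exp (by linarith : 0 ≤ 5 * C₀)]
  exact theorem2_general hn hX hdep (fun k hk ↦ hν₁ ▸ factMoment1_congr (hid k hk))
    (fun k hk ↦ (hν₂ ▸ factMoment2_congr (hid k hk)).le) (fun k hk ↦ (hκ ▸ hmix k hk).le)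
    (fun k hk ↦ (hid k hk).symm.ae_snd (p := fun m : ℕ ↦ (m : ℝ) ≤ C₀)
      (Set.to_countable _).measurableSet hbound)
    hν_pos (by linarith) hy (le_of_abs_le hy') hx
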